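/- Let $H_k$ be the (physicists') Hermite polynomials and let $h_k(x)=(2^k k!\sqrt{\pi})^{-1/2}H_k(x)e^{-x^2/2}$, $k=0,1,2,\dots$, be the Hermite functions, normalized so that $\|h_k\|_{L^2(\mathbb{R})}=1$. Functions are complex-valued on $\mathbb{R}$ and identified when they are equal almost everywhere. Let $$V=\{\phi\in L^2_{\mathrm{loc}}(\mathbb{R}) : \|\phi h_k\|_2<\infty \text{ for all } k\ge 0 \text{ and } \lim_{k\to\infty}\|\phi h_k\|_2=0\},\qquad \|\phi\|_V=\sup_{k\ge 0}\|\phi h_k\|_2 .$$ For $2\le p<\infty$ and $\alpha\in\mathbb{R}$ let $$L(p,\alpha)=\{b : (1+x^2)^{-\alpha/2}\,b\in L^p(\mathbb{R})\},\qquad \|b\|_{L(p,\alpha)}=\|(1+x^2)^{-\alpha/2}b\|_p ,$$ and put $$t(p)=-\tfrac1{12}\left(2-\tfrac2p\right)\ \text{ for } 2\le p<4,\qquad t(p)=-\tfrac1{2p}\ \text{ for } 4\le p<\infty$$ (both formulas give $t(4)=-\tfrac18$). Finally let $$L^\infty_0(\mathbb{R})=\{\phi\in L^\infty(\mathbb{R})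 : \operatorname{ess\,sup}_{|s|\ge t}|\phi(s)|\to 0 \text{ as } t\to\infty\}$$ with the norm of $L^\infty(\mathbb{R})$. A normed space $X$ of functions embeds continuously in $V$ if $X\subseteq V$ and there is a constant $C$ with $\|b\|_V\le C\|b\|_X$ for all $b\in X$. Then: 1. $L(p,\alpha)$ embeds continuously in $V$ whenever $2\le p<\infty$, $\alpha\in\mathbb{R}$, $\alpha/2+t(p)\le 0$ and $(p,\alpha)\ne(4,1/4)$. 2. $L^\infty_0(\mathbb{R})$ embeds continuously in $V$. 3. In particular, $L^p(\mathbb{R})$ embeds continuously in $V$ for every $2\le p<\infty$. -/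

import Mathlib

open MeasureTheory Filter Topology
open scoped ENNReal NNReal Nat

/-- The `L²`-normalized Hermite functions
`h_k(x) = (2^k k! √π)^{-1/2} H_k(x) e^{-x²/2}`, the eigenfunctions of `-d²/dx² + x²`.
`Polynomial.hermite` is the probabilists' polynomial `He_k`, and `H_k(x) = 2^{k/2} He_k(√2 x)`,
so that `h_k(x) = (k! √π)^{-1/2} He_k(√2 x) e^{-x²/2}`. -/
noncomputable def hermiteFn (k : ℕ) (x : ℝ) : ℝ :=
  (√((k ! : ℝ) * √Real.pi))⁻¹ * Polynomial.aeval (√2 * x) (Polynomial.hermite k)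
    * Real.exp (-x ^ 2 / 2)

/-- The norm `‖φ h_k‖_2`, with values in `[0, ∞]`. -/
noncomputable def hermiteNorm (k : ℕ) (f : ℝ →ₘ[volume] ℂ) : ℝ≥0∞ :=
  eLpNorm (fun x => f x * (hermiteFn k x : ℂ)) 2 volume

/-- The norm `sup_k ‖φ h_k‖_2` of `V`. -/
noncomputable def vNorm (f : ℝ →ₘ[volume] ℂ) : ℝ≥0∞ :=
  ⨆ k : ℕ, hermiteNorm k f

/-- The norm `‖(1 + x²)^{-α/2} b‖_p` of `L(p, α)`. -/
noncomputable def weightedNorm (p α : ℝ) (f : ℝ →ₘ[volume] ℂ) : ℝ≥0∞ :=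
  eLpNorm (fun x => (((1 + x ^ 2) ^ (-α / 2) : ℝ) : ℂ) * f x) (ENNReal.ofReal p) volume

/-- The essential supremum of `|φ(s)|` over `|s| ≥ t`. -/
noncomputable def tailNorm (t : ℝ) (f : ℝ →ₘ[volume] ℂ) : ℝ≥0∞ :=
  eLpNorm f ∞ (volume.restrict {s : ℝ | t ≤ |s|})

theorem continuous_hermiteFn (k : ℕ) : Continuous (hermiteFn k) := by
  unfold hermiteFn
  have : Continuous fun x : ℝ => Polynomial.aeval (√2 * x) (Polynomial.hermite k) :=
    (Polynomial.continuous_aeval (Polynomial.hermite k)).comp (by fun_prop)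
  fun_prop

theorem aesm_mul_hermiteFn (k : ℕ) (f : ℝ →ₘ[volume] ℂ) :
    AEStronglyMeasurable (fun x => f x * (hermiteFn k x : ℂ)) volume :=
  f.aestronglyMeasurable.mul
    (Complex.continuous_ofReal.comp (continuous_hermiteFn k)).aestronglyMeasurable

theorem hermiteNorm_add_le (k : ℕ) (f g : ℝ →ₘ[volume] ℂ) :
    hermiteNorm k (f + g) ≤ hermiteNorm k f + hermiteNorm k g := by
  refine (eLpNorm_congr_ae ?_).trans_le (eLpNorm_add_le (aesm_mul_hermiteFn k f)
    (aesm_mul_hermiteFn k g) (by norm_num))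
  filter_upwards [AEEqFun.coeFn_add f g] with x hx
  simp only [hx, Pi.add_apply, add_mul]

theorem hermiteNorm_smul (k : ℕ) (c : ℂ) (f : ℝ →ₘ[volume] ℂ) :
    hermiteNorm k (c • f) = ‖c‖ₑ * hermiteNorm k f := by
  unfold hermiteNorm
  rw [← eLpNorm_const_smul]
  refine eLpNorm_congr_ae ?_
  filter_upwards [AEEqFun.coeFn_smul c f] with x hx
  simp only [hx, Pi.smul_apply, smul_eq_mul, mul_assoc]

theorem hermiteNorm_zero (k : ℕ) : hermiteNorm k 0 = 0 := by
  refine (eLpNorm_congr_ae ?_).trans (eLpNorm_zero (ε := ℂ))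
  filter_upwards [AEEqFun.coeFn_zero (μ := volume) (α := ℝ) (β := ℂ)] with x hx
  simp [hx]

theorem tailNorm_add_le (t : ℝ) (f g : ℝ →ₘ[volume] ℂ) :
    tailNorm t (f + g) ≤ tailNorm t f + tailNorm t g := by
  refine (eLpNorm_congr_ae (ae_restrict_of_ae (AEEqFun.coeFn_add f g))).trans_le
    (eLpNorm_add_le f.aestronglyMeasurable.restrict g.aestronglyMeasurable.restrict le_top)

theorem tailNorm_smul (t : ℝ) (c : ℂ) (f : ℝ →ₘ[volume] ℂ) :
    tailNorm t (c • f) = ‖c‖ₑ * tailNorm t f := by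
  unfold tailNorm
  rw [← eLpNorm_const_smul]
  exact eLpNorm_congr_ae (ae_restrict_of_ae (AEEqFun.coeFn_smul c f))

theorem tailNorm_zero (t : ℝ) : tailNorm t 0 = 0 := by
  exact (eLpNorm_congr_ae (ae_restrict_of_ae AEEqFun.coeFn_zero)).trans eLpNorm_zero

/-- The space `V`, as a space of classes of measurable functions up to a.e. equality:
all `φ ∈ L²_loc(ℝ)` with `‖φ h_k‖_2 < ∞` for all `k` and `‖φ h_k‖_2 → 0`. -/
noncomputable def vSpace : Submodule ℂ (ℝ →ₘ[volume] ℂ) where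
  carrier := {f | (∀ K : Set ℝ, IsCompact K → MemLp f 2 (volume.restrict K)) ∧
    (∀ k, hermiteNorm k f < ∞) ∧ Tendsto (fun k => hermiteNorm k f) atTop (𝓝 0)}
  add_mem' := by
    rintro f g ⟨hf1, hf2, hf3⟩ ⟨hg1, hg2, hg3⟩
    refine ⟨fun K hK => ?_, fun k => ?_, ?_⟩
    · exact ((hf1 K hK).add (hg1 K hK)).ae_eq (ae_restrict_of_ae (AEEqFun.coeFn_add f g).symm)
    · exact (hermiteNorm_add_le k f g).trans_lt (ENNReal.add_lt_top.2 ⟨hf2 k, hg2 k⟩)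
    · exact tendsto_of_tendsto_of_tendsto_of_le_of_le tendsto_const_nhds
        (by simpa using hf3.add hg3) (fun _ => zero_le) (fun k => hermiteNorm_add_le k f g)
  zero_mem' := by
    refine ⟨fun K _ => ?_, fun k => by simp [hermiteNorm_zero], by simp [hermiteNorm_zero]⟩
    exact MemLp.zero.ae_eq (ae_restrict_of_ae (AEEqFun.coeFn_zero (μ := volume)).symm)
  smul_mem' := by
    rintro c f ⟨hf1, hf2, hf3⟩
    refine ⟨fun K hK => ?_, fun k => ?_, ?_⟩
    · exact ((hf1 K hK).const_smul c).ae_eq (ae_restrict_of_ae (AEEqFun.coeFn_smul c f).symm)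
    · rw [hermiteNorm_smul]
      exact ENNReal.mul_lt_top enorm_lt_top (hf2 k)
    · simp only [hermiteNorm_smul]
      simpa using ENNReal.Tendsto.const_mul (a := ‖c‖ₑ) hf3 (Or.inr enorm_ne_top)

/-- The weighted space `L(p, α)`: all `b` with `(1 + x²)^{-α/2} b ∈ L^p(ℝ)`. -/
noncomputable def weightedSpace (p α : ℝ) : Submodule ℂ (ℝ →ₘ[volume] ℂ) where
  carrier := {f | MemLp (fun x => (((1 + x ^ 2) ^ (-α / 2) : ℝ) : ℂ) * f x)
    (ENNReal.ofReal p) volume}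
  add_mem' := by
    intro f g hf hg
    refine (hf.add hg).ae_eq ?_
    filter_upwards [AEEqFun.coeFn_add f g] with x hx
    simp only [hx, Pi.add_apply, mul_add]
  zero_mem' := by
    refine (MemLp.zero (ε := ℂ)).ae_eq ?_
    filter_upwards [AEEqFun.coeFn_zero (μ := volume) (α := ℝ) (β := ℂ)] with x hx
    simp [hx]
  smul_mem' := by
    intro c f hf
    refine (hf.const_smul c).ae_eq ?_
    filter_upwards [AEEqFun.coeFn_smul c f] with x hx
    simp only [hx, Pi.smul_apply, smul_eq_mul]
    ring

/-- The space `L^∞_0(ℝ)` of all `φ ∈ L^∞(ℝ)` with `ess sup_{|s| ≥ t} |φ(s)| → 0` as `t → ∞`. -/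
noncomputable def linftyZero : Submodule ℂ (ℝ →ₘ[volume] ℂ) where
  carrier := {f | MemLp f ∞ volume ∧ Tendsto (fun t : ℝ => tailNorm t f) atTop (𝓝 0)}
  add_mem' := by
    rintro f g ⟨hf1, hf2⟩ ⟨hg1, hg2⟩
    refine ⟨(hf1.add hg1).ae_eq (AEEqFun.coeFn_add f g).symm, ?_⟩
    exact tendsto_of_tendsto_of_tendsto_of_le_of_le tendsto_const_nhds
      (by simpa using hf2.add hg2) (fun _ => zero_le) (fun t => tailNorm_add_le t f g)
  zero_mem' := by
    refine ⟨MemLp.zero.ae_eq (AEEqFun.coeFn_zero (μ := volume)).symm, by simp [tailNorm_zero]⟩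
  smul_mem' := by
    rintro c f ⟨hf1, hf2⟩
    refine ⟨(hf1.const_smul c).ae_eq (AEEqFun.coeFn_smul c f).symm, ?_⟩
    simp only [tailNorm_smul]
    simpa using ENNReal.Tendsto.const_mul (a := ‖c‖ₑ) hf2 (Or.inr enorm_ne_top)

/-- The exponent `t(p)`; at `p = 4` both formulas give `-1/8`. -/
noncomputable def tExp (p : ℝ) : ℝ :=
  if p < 4 then -(1 / 12) * (2 - 2 / p) else -(1 / (2 * p))

/-- The space `X`, with the norm `nX`, is continuously embedded in the space `Y`, with the
norm `nY`: `X ⊆ Y` and the inclusion is bounded. -/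
def ContEmbeds (X : Submodule ℂ (ℝ →ₘ[volume] ℂ)) (nX : (ℝ →ₘ[volume] ℂ) → ℝ≥0∞)
    (Y : Submodule ℂ (ℝ →ₘ[volume] ℂ)) (nY : (ℝ →ₘ[volume] ℂ) → ℝ≥0∞) : Prop :=
  X ≤ Y ∧ ∃ C : ℝ≥0, ∀ f ∈ X, nY f ≤ C * nX f

/-! By Hölder with `1/p + 1/q = 1/2`, `‖b h_k‖_2` is at most `‖b‖_{L(p,α)}` times the `L^q` norm of
`(1 + x²)^{α/2} h_k`, so boundedness reduces to bounding the latter uniformly in `k`. Convergence to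
zero then comes by approximation: `sup |h_k| → 0` settles every `b ∈ L²`, and elements of the given
spaces are approximated by `L²` functions.

The uniform bound needs the size of `h_k` near its turning points. With `s = (2k+1)^{1/6}`, `u =
h_k` solves `u'' = (x² - s⁶) u`. Energy and monotonicity arguments for this equation alone, with no
asymptotic expansion, give `|u| ≲ s^{-1/2} (1 + z)^{-1/4}` for `z = s (s³ - |x|) ≥ 0` and `|u| ≲
s^{-1/2} e^z` for `z < 0` (`oscillator_oscillatory_bound`, `oscillator_decay_bound`). Including the
weight gives `weighted_hermiteFn_le`; integrating over `z` gives `eLpNorm_weighted_hermiteFn_le`.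
For `q > 4` the turning points dominate, for `q < 4` the bulk does: hence the two formulas for
`t(p)`, and a logarithm at `(4, 1/4)`. -/

/-! ### Hermite functions: recurrences, differential equation, decay and values at the origin. -/

theorem derivative_hermite_succ (k : ℕ) :
    Polynomial.derivative (Polynomial.hermite (k + 1))
      = ((k : Polynomial ℤ) + 1) * Polynomial.hermite k := by
  induction k with
  | zero => simp
  | succ k ih =>
    rw [Polynomial.hermite_succ (k + 1), Polynomial.derivative_sub, Polynomial.derivative_mul, ih,
      Polynomial.derivative_mul, Polynomial.hermite_succ k]
    simp only [Polynomial.derivative_X, Polynomial.derivative_add, Polynomial.derivative_natCast,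
      Polynomial.derivative_one]
    push_cast
    ring

theorem hermite_comp_neg_X (k : ℕ) :
    (Polynomial.hermite k).comp (-Polynomial.X)
      = Polynomial.C ((-1) ^ k) * Polynomial.hermite k := by
  induction k with
  | zero => simp
  | succ k ih =>
    have h := congrArg Polynomial.derivative ih
    rw [Polynomial.derivative_comp] at h
    simp only [Polynomial.derivative_neg, Polynomial.derivative_X,
      Polynomial.derivative_C_mul] at h
    rw [Polynomial.hermite_succ, Polynomial.sub_comp, Polynomial.mul_comp, Polynomial.X_comp, ih, pow_succ,
      Polynomial.C_mul, Polynomial.C_neg, Polynomial.C_1]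
    linear_combination h

theorem hermiteFn_neg (k : ℕ) (x : ℝ) : hermiteFn k (-x) = (-1) ^ k * hermiteFn k x := by
  have h := congrArg (Polynomial.aeval (√2 * x)) (hermite_comp_neg_X k)
  rw [Polynomial.aeval_comp] at h
  simp only [map_neg, map_mul, Polynomial.aeval_X, map_pow, map_one] at h
  simp only [hermiteFn, mul_neg, h, neg_sq]
  ring

theorem hermiteFn_normalization (k : ℕ) :
    (√((k ! : ℝ) * √Real.pi))⁻¹ = √(k + 1 : ℝ) * (√(((k + 1)! : ℕ) * √Real.pi))⁻¹ := by
  have h1 : (0 : ℝ) < (k ! : ℝ) * √Real.pi := by positivity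
  rw [Nat.factorial_succ]
  push_cast
  rw [mul_assoc, Real.sqrt_mul (by positivity : (0 : ℝ) ≤ k + 1)]
  have h2 : 0 < √(k + 1 : ℝ) := by positivity
  field_simp

/-- The raising-operator form of the derivative. With the lowering form in `hasDerivAt_hermiteFn` it
yields the second-order equation. -/
theorem hasDerivAt_hermiteFn_succ (k : ℕ) (x : ℝ) :
    HasDerivAt (hermiteFn k) (x * hermiteFn k x - √(2 * (k + 1)) * hermiteFn (k + 1) x) x := by
  have h1 : HasDerivAt (fun x : ℝ => Polynomial.aeval (√2 * x) (Polynomial.hermite k))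
      (Polynomial.aeval (√2 * x) (Polynomial.derivative (Polynomial.hermite k)) * √2) x := by
    exact ((Polynomial.hasDerivAt_aeval (Polynomial.hermite k) (√2 * x)).comp x
      ((hasDerivAt_id x).const_mul √2)).congr_deriv (by simp)
  have h2 : HasDerivAt (fun x : ℝ => Real.exp (-x ^ 2 / 2)) (Real.exp (-x ^ 2 / 2) * (-x)) x := by
    have : HasDerivAt (fun x : ℝ => -x ^ 2 / 2) (-x) x := by
      exact ((hasDerivAt_pow 2 x).neg.div_const 2).congr_deriv (by norm_num; ring)
    exact this.exp
  have h3 := ((h1.const_mul (√((k ! : ℝ) * √Real.pi))⁻¹).mul h2)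
  refine h3.congr_deriv ?_
  have h4 : Polynomial.aeval (√2 * x) (Polynomial.hermite (k + 1)) =
      √2 * x * Polynomial.aeval (√2 * x) (Polynomial.hermite k)
        - Polynomial.aeval (√2 * x) (Polynomial.derivative (Polynomial.hermite k)) := by
    simp [Polynomial.hermite_succ]
  have h5 : √2 * √2 = (2 : ℝ) := Real.mul_self_sqrt (by norm_num)
  simp only [hermiteFn, h4]
  rw [hermiteFn_normalization k, Real.sqrt_mul (by norm_num : (0 : ℝ) ≤ 2)]
  linear_combination (√(k + 1 : ℝ) * (√(((k + 1)! : ℕ) * √Real.pi))⁻¹ * x *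
    Polynomial.aeval (√2 * x) (Polynomial.hermite k) * Real.exp (-x ^ 2 / 2)) * h5

theorem hermiteFn_recurrence (k : ℕ) (x : ℝ) :
    √(2 * (k + 2)) * hermiteFn (k + 2) x
      = 2 * x * hermiteFn (k + 1) x - √(2 * (k + 1)) * hermiteFn k x := by
  have h4 : Polynomial.aeval (√2 * x) (Polynomial.hermite (k + 2)) =
      √2 * x * Polynomial.aeval (√2 * x) (Polynomial.hermite (k + 1))
        - (k + 1) * Polynomial.aeval (√2 * x) (Polynomial.hermite k) := by
    rw [Polynomial.hermite_succ (k + 1), derivative_hermite_succ]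
    simp
  have h5 : √2 * √2 = (2 : ℝ) := Real.mul_self_sqrt (by norm_num)
  have h6 : √(k + 1 : ℝ) * √(k + 1) = (k + 1 : ℝ) := Real.mul_self_sqrt (by positivity)
  have h7 : (√(((k + 1)! : ℕ) * √Real.pi))⁻¹ =
      √(k + 2 : ℝ) * (√(((k + 2)! : ℕ) * √Real.pi))⁻¹ := by
    have := hermiteFn_normalization (k + 1)
    rwa [show ((k + 1 : ℕ) : ℝ) + 1 = k + 2 by push_cast; ring] at this
  simp only [hermiteFn, h4]
  rw [hermiteFn_normalization k, h7, Real.sqrt_mul (by norm_num : (0 : ℝ) ≤ 2),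
    Real.sqrt_mul (by norm_num : (0 : ℝ) ≤ 2)]
  set P := Polynomial.aeval (√2 * x) (Polynomial.hermite k)
  set Q := Polynomial.aeval (√2 * x) (Polynomial.hermite (k + 1))
  set A := (√(((k + 2)! : ℕ) * √Real.pi))⁻¹
  set E := Real.exp (-x ^ 2 / 2)
  linear_combination (√(k + 2 : ℝ) * A * E * x * Q) * h5 + √2 * √(k + 2 : ℝ) * A * E * P * h6

/-- The derivative of `hermiteFn k`. -/
noncomputable def hermiteFnDeriv (k : ℕ) (x : ℝ) : ℝ :=
  √(2 * k) * hermiteFn (k - 1) x - x * hermiteFn k x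

theorem hasDerivAt_hermiteFn (k : ℕ) (x : ℝ) :
    HasDerivAt (hermiteFn k) (hermiteFnDeriv k x) x := by
  refine (hasDerivAt_hermiteFn_succ k x).congr_deriv ?_
  cases k with
  | zero =>
    have h5 : √2 * √2 = (2 : ℝ) := Real.mul_self_sqrt (by norm_num)
    simp [hermiteFnDeriv, hermiteFn]
    linear_combination (-x * (√√Real.pi)⁻¹ * Real.exp (-x ^ 2 / 2)) * h5
  | succ k =>
    have h := hermiteFn_recurrence k x
    simp only [hermiteFnDeriv, Nat.add_sub_cancel]
    push_cast
    rw [add_assoc, one_add_one_eq_two]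
    linear_combination -h

theorem hasDerivAt_hermiteFnDeriv (k : ℕ) (x : ℝ) :
    HasDerivAt (hermiteFnDeriv k) ((x ^ 2 - (2 * k + 1)) * hermiteFn k x) x := by
  have h1 := (hasDerivAt_id x).mul (hasDerivAt_hermiteFn k x)
  have h2 := ((hasDerivAt_hermiteFn_succ (k - 1) x).const_mul √(2 * (k : ℝ))).sub h1
  refine h2.congr_deriv ?_
  -- At `k = 0` the truncated index `k - 1` is harmless, because its coefficient `√(2k)` vanishes.
  cases k with
  | zero => simp [hermiteFnDeriv]; ring
  | succ k =>
    have h5 : √(2 * (k + 1) : ℝ) * √(2 * (k + 1)) = (2 * (k + 1) : ℝ) :=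
      Real.mul_self_sqrt (by positivity)
    simp only [hermiteFnDeriv, Nat.add_sub_cancel, id]
    push_cast
    linear_combination -hermiteFn (k + 1) x * h5

theorem tendsto_mul_hermiteFn (P : Polynomial ℝ) (k : ℕ) :
    Tendsto (fun x => P.eval x * hermiteFn k x) atTop (𝓝 0) := by
  let Q : Polynomial ℝ := P * Polynomial.C (√((k ! : ℝ) * √Real.pi))⁻¹ *
    ((Polynomial.hermite k).map (Int.castRingHom ℝ)).comp (Polynomial.C √2 * Polynomial.X)
  have hQ : ∀ x, P.eval x * hermiteFn k x = Q.eval x / Real.exp x *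
      Real.exp (x - x ^ 2 / 2) := by
    intro x
    have : Q.eval x = P.eval x * (√((k ! : ℝ) * √Real.pi))⁻¹ *
        Polynomial.aeval (√2 * x) (Polynomial.hermite k) := by
      simp [Q, Polynomial.aeval_def, Polynomial.eval_map]
    rw [this, hermiteFn, show -x ^ 2 / 2 = (x - x ^ 2 / 2) - x by ring, Real.exp_sub]
    ring
  simp only [hQ]
  refine (Polynomial.tendsto_div_exp_atTop Q).zero_mul_isBoundedUnder_le ?_
  refine ⟨Real.exp 1, ?_⟩
  simp only [eventually_map]
  refine Eventually.of_forall fun x => ?_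
  simp only [Function.comp, Real.norm_eq_abs, Real.abs_exp]
  exact Real.exp_le_exp.2 (by nlinarith [sq_nonneg (x - 1)])

theorem tendsto_hermiteFn (k : ℕ) : Tendsto (hermiteFn k) atTop (𝓝 0) := by
  simpa using tendsto_mul_hermiteFn 1 k

theorem tendsto_id_mul_hermiteFn (k : ℕ) :
    Tendsto (fun x => x * hermiteFn k x) atTop (𝓝 0) := by
  simpa using tendsto_mul_hermiteFn Polynomial.X k

theorem tendsto_hermiteFnDeriv (k : ℕ) : Tendsto (hermiteFnDeriv k) atTop (𝓝 0) := by
  have h := ((tendsto_hermiteFn (k - 1)).const_mul √(2 * (k : ℝ))).sub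
    (tendsto_id_mul_hermiteFn k)
  rwa [mul_zero, sub_zero] at h

/-- At `x = 0` the recurrence reads `(k+2) h_{k+2}(0)² = (k+1) h_k(0)²`, and `h_1(0) = 0`. The bound
supplies the initial energy for the differential equation. -/
theorem hermiteFn_zero_pow_four (k : ℕ) : (hermiteFn k 0) ^ 4 * (k + 1) ≤ 1 := by
  induction k using Nat.twoStepInduction with
  | zero =>
    have h1 : hermiteFn 0 0 ^ 2 = (√Real.pi)⁻¹ := by
      simp [hermiteFn]
    have h2 : hermiteFn 0 0 ^ 4 = Real.pi⁻¹ := by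
      rw [show hermiteFn 0 0 ^ 4 = (hermiteFn 0 0 ^ 2) ^ 2 by ring, h1, inv_pow,
        Real.sq_sqrt Real.pi_pos.le]
    rw [h2]
    have : Real.pi⁻¹ ≤ 1 := inv_le_one_of_one_le₀ (by linarith [Real.pi_gt_three])
    simpa using this
  | one => simp [hermiteFn]
  | more k ih _ =>
    have h := hermiteFn_recurrence k 0
    have h5 : √(2 * (k + 1) : ℝ) ^ 2 = (2 * (k + 1) : ℝ) := Real.sq_sqrt (by positivity)
    have h6 : √(2 * (k + 2) : ℝ) ^ 2 = (2 * (k + 2) : ℝ) := Real.sq_sqrt (by positivity)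
    have h7 : (k + 2 : ℝ) * hermiteFn (k + 2) 0 ^ 2 = (k + 1) * hermiteFn k 0 ^ 2 := by
      have := congrArg (· ^ 2) h
      simp only [mul_pow, mul_zero, zero_mul, zero_sub, neg_sq, h5, h6] at this
      linarith
    have h8 : hermiteFn (k + 2) 0 ^ 4 = (k + 1) ^ 2 / (k + 2) ^ 2 * hermiteFn k 0 ^ 4 := by
      field_simp
      linear_combination ((k + 2 : ℝ) * hermiteFn (k + 2) 0 ^ 2 + (k + 1) * hermiteFn k 0 ^ 2) * h7
    rw [h8]
    push_cast
    refine le_trans ?_ ih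
    -- This is `(k+1)(k+3) ≤ (k+2)²`.
    have h9 : ((k : ℝ) + 1) ^ 2 / (k + 2) ^ 2 * (k + 2 + 1) ≤ k + 1 := by
      rw [div_mul_eq_mul_div, div_le_iff₀ (by positivity)]
      nlinarith [Nat.cast_nonneg (α := ℝ) k]
    have h10 : 0 ≤ hermiteFn k 0 ^ 4 := by positivity
    nlinarith

/-! ### Bounds for solutions of `u'' = (x² - s⁶) u` with controlled energy at the origin. -/

section OscillatorODE

variable {u v : ℝ → ℝ} {s : ℝ}

/-- With `R = √(s⁶ - x²)`, the adiabatic energy `G = R u² + v²/R` satisfies `G' = w (uv)'` for `w =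
x/R³`, hence `(G - w uv)' = -w' uv`. As `2|uv| ≤ G` and `0 ≤ w ≤ 1`, a Gronwall argument with factor
`e^{-w}` bounds the growth by `e`. Stopping at distance `1/s` from the turning point ensures `R ≥
s`, and so `w ≤ 1`. -/
theorem oscillator_energy_bound (hs : 1 ≤ s)
    (hu : ∀ x, HasDerivAt u (v x) x) (hv : ∀ x, HasDerivAt v ((x ^ 2 - s ^ 6) * u x) x)
    (h0 : s ^ 3 * u 0 ^ 2 + v 0 ^ 2 / s ^ 3 ≤ 3) {x : ℝ} (hx0 : 0 ≤ x) (hx : x ≤ s ^ 3 - 1 / s) :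
    √(s ^ 6 - x ^ 2) * u x ^ 2 + v x ^ 2 / √(s ^ 6 - x ^ 2) ≤ 18 := by
  have hs0 : 0 < s := by linarith
  have hQ : ∀ y, 0 ≤ y → y ≤ s ^ 3 - 1 / s → s ^ 2 ≤ s ^ 6 - y ^ 2 := by
    intro y hy0 hy
    have h1 : 1 / s ≤ s ^ 3 - y := by linarith
    have h2 : 1 / s * s ^ 3 ≤ (s ^ 3 - y) * (s ^ 3 + y) := by
      apply mul_le_mul h1 (by linarith) (by positivity) (le_trans (by positivity) h1)
    have h3 : 1 / s * s ^ 3 = s ^ 2 := by field_simp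
    nlinarith
  let R : ℝ → ℝ := fun y => √(s ^ 6 - y ^ 2)
  have hRs : ∀ y, 0 ≤ y → y ≤ s ^ 3 - 1 / s → s ≤ R y := fun y hy0 hy =>
    Real.le_sqrt_of_sq_le (hQ y hy0 hy)
  have hR2 : ∀ y, 0 ≤ y → y ≤ s ^ 3 - 1 / s → R y ^ 2 = s ^ 6 - y ^ 2 := fun y hy0 hy =>
    Real.sq_sqrt (le_trans (by positivity) (hQ y hy0 hy))
  have hRd : ∀ y, 0 ≤ y → y ≤ s ^ 3 - 1 / s → HasDerivAt R (-y / R y) y := by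
    intro y hy0 hy
    have h1 : HasDerivAt (fun y : ℝ => s ^ 6 - y ^ 2) (-(2 * y)) y := by
      simpa using (hasDerivAt_pow 2 y).const_sub (s ^ 6)
    have hne : s ^ 6 - y ^ 2 ≠ 0 := (lt_of_lt_of_le (by positivity) (hQ y hy0 hy)).ne'
    refine (h1.sqrt hne).congr_deriv ?_
    have : R y ≠ 0 := (hs0.trans_le (hRs y hy0 hy)).ne'
    change -(2 * y) / (2 * R y) = _
    field_simp
  let w : ℝ → ℝ := fun y => y / R y ^ 3
  let w' : ℝ → ℝ := fun y => 1 / R y ^ 3 + 3 * y ^ 2 / R y ^ 5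
  have hwd : ∀ y, 0 ≤ y → y ≤ s ^ 3 - 1 / s → HasDerivAt w (w' y) y := by
    intro y hy0 hy
    have hR : R y ≠ 0 := (hs0.trans_le (hRs y hy0 hy)).ne'
    refine ((hasDerivAt_id y).div ((hRd y hy0 hy).pow 3) (pow_ne_zero 3 hR)).congr_deriv ?_
    simp only [w', id, Pi.pow_apply]
    field_simp
    ring
  have hw : ∀ y, 0 ≤ y → y ≤ s ^ 3 - 1 / s → 0 ≤ w y ∧ w y ≤ 1 := by
    intro y hy0 hy
    have hR := hRs y hy0 hy
    have hRp : 0 < R y := by linarith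
    refine ⟨by positivity, ?_⟩
    rw [div_le_one (by positivity)]
    calc y ≤ s ^ 3 := by have : 0 < 1 / s := by positivity
                         linarith
      _ ≤ R y ^ 3 := by gcongr
  let G : ℝ → ℝ := fun y => R y * u y ^ 2 + v y ^ 2 / R y
  have hGuv : ∀ y, 0 ≤ y → y ≤ s ^ 3 - 1 / s → 2 * |u y * v y| ≤ G y := by
    intro y hy0 hy
    have hRp : 0 < R y := by have := hRs y hy0 hy; linarith
    have h1 : R y * G y = (R y * u y) ^ 2 + v y ^ 2 := by
      simp only [G]; field_simp
    have h2 : R y * (2 * |u y * v y|) ≤ R y * G y := by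
      rw [h1]
      have h3 : R y * (2 * |u y * v y|) = 2 * |R y * u y| * |v y| := by
        rw [abs_mul, abs_mul, abs_of_pos hRp]; ring
      rw [h3]
      nlinarith [sq_nonneg (|R y * u y| - |v y|), sq_abs (R y * u y), sq_abs (v y)]
    exact le_of_mul_le_mul_left h2 hRp
  let H : ℝ → ℝ := fun y => Real.exp (-w y) * (G y - w y * (u y * v y))
  have hHd : ∀ y, 0 ≤ y → y ≤ s ^ 3 - 1 / s → HasDerivAt H
      (-(w' y * Real.exp (-w y) * (G y - w y * (u y * v y) + u y * v y))) y := by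
    intro y hy0 hy
    have hR : R y ≠ 0 := (hs0.trans_le (hRs y hy0 hy)).ne'
    have hGd := ((hRd y hy0 hy).mul ((hu y).pow 2)).add (((hv y).pow 2).div (hRd y hy0 hy) hR)
    refine ((hwd y hy0 hy).neg.exp.mul
      (hGd.sub ((hwd y hy0 hy).mul ((hu y).mul (hv y))))).congr_deriv ?_
    have h2 : y ^ 2 - s ^ 6 = -R y ^ 2 := by rw [hR2 y hy0 hy]; ring
    simp only [w', w, G, Pi.pow_apply, Pi.mul_apply, Pi.add_apply, Pi.sub_apply, Pi.div_apply, Pi.neg_apply, h2]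
    field_simp
    ring
  have hanti : AntitoneOn H (Set.Icc 0 (s ^ 3 - 1 / s)) := by
    refine antitoneOn_of_deriv_nonpos (convex_Icc _ _)
      (fun y hy => (hHd y hy.1 hy.2).continuousAt.continuousWithinAt)
      (fun y hy => ?_) (fun y hy => ?_)
    · rw [interior_Icc] at hy
      exact (hHd y hy.1.le hy.2.le).differentiableAt.differentiableWithinAt
    · rw [interior_Icc] at hy
      rw [(hHd y hy.1.le hy.2.le).deriv]
      have hRp : 0 < R y := by have := hRs y hy.1.le hy.2.le; linarith
      have hy0 := hy.1.le
      have h1 : 0 ≤ w' y := by positivity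
      have h2 := hGuv y hy.1.le hy.2.le
      have h3 := hw y hy.1.le hy.2.le
      have h4 : |(1 - w y) * (u y * v y)| ≤ |u y * v y| := by
        rw [abs_mul]
        refine mul_le_of_le_one_left (abs_nonneg _) ?_
        rw [abs_le]; constructor <;> linarith
      have h5 := neg_abs_le ((1 - w y) * (u y * v y))
      have h6 : 0 ≤ G y - w y * (u y * v y) + u y * v y := by
        have := abs_nonneg (u y * v y)
        linarith
      rw [neg_nonpos]
      positivity
  have hH := hanti (Set.left_mem_Icc.2 (hx0.trans hx)) ⟨hx0, hx⟩ hx0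
  have hH0 : H 0 ≤ 3 := by
    have : R 0 = s ^ 3 := by
      simp only [R]
      rw [show s ^ 6 - 0 ^ 2 = (s ^ 3) ^ 2 by ring, Real.sqrt_sq (by positivity)]
    simpa [H, w, G, this] using h0
  have hwx := hw x hx0 hx
  have hGx := hGuv x hx0 hx
  have h1 : G x / 2 ≤ G x - w x * (u x * v x) := by
    have h2 : |w x * (u x * v x)| ≤ |u x * v x| := by
      rw [abs_mul]
      refine mul_le_of_le_one_left (abs_nonneg _) ?_
      rw [abs_le]; constructor <;> linarith
    have := le_abs_self (w x * (u x * v x))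
    linarith
  have h3 : G x - w x * (u x * v x) ≤ 3 * Real.exp 1 := by
    have h4 : G x - w x * (u x * v x) = Real.exp (w x) * H x := by
      simp only [H]
      rw [← mul_assoc (Real.exp _), ← Real.exp_add]; simp
    rw [h4]
    calc Real.exp (w x) * H x ≤ Real.exp (w x) * 3 := by gcongr; linarith
      _ ≤ Real.exp 1 * 3 := by gcongr; exact hwx.2
      _ = _ := by ring
  -- `G ≤ 2 (G - w uv) ≤ 6e < 18`.
  have h5 := Real.exp_one_lt_d9
  change G x ≤ 18
  linarith

/-- The energy `v² + (s⁶ - x²) u²` has derivative `-2x u²`, so it decreases and keeps `|v| ≤ 6√s` up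
to the turning point. Over a window of width `1/s`, `u` then moves by at most `6/√s` from a value of
size at most `5/√s`. -/
theorem oscillator_transition_bound (hs : 1 ≤ s)
    (hu : ∀ x, HasDerivAt u (v x) x) (hv : ∀ x, HasDerivAt v ((x ^ 2 - s ^ 6) * u x) x)
    (h0 : s ^ 3 * u 0 ^ 2 + v 0 ^ 2 / s ^ 3 ≤ 3) {x : ℝ} (hx1 : s ^ 3 - 1 / s ≤ x)
    (hx : x ≤ s ^ 3) : u x ^ 2 ≤ 121 / s := by
  have hs0 : 0 < s := by linarith
  set a := s ^ 3 - 1 / s with ha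
  have hinv : 1 / s ≤ 1 := by rw [div_le_one hs0]; exact hs
  have ha0 : 0 ≤ a := by
    have : 1 ≤ s ^ 3 := one_le_pow₀ hs
    linarith
  have hG := oscillator_energy_bound hs hu hv h0 ha0 le_rfl
  have hQ : s ^ 6 - a ^ 2 = 2 * s ^ 2 - 1 / s ^ 2 := by rw [ha]; field_simp; ring
  set R := √(s ^ 6 - a ^ 2) with hR
  have hs2 : 1 / s ^ 2 ≤ s ^ 2 := by
    have : 1 ≤ s ^ 2 := one_le_pow₀ hs
    rw [div_le_iff₀ (by positivity)]; nlinarith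
  have hRs : s ≤ R := Real.le_sqrt_of_sq_le (by rw [hQ]; linarith)
  have hR2 : R ^ 2 = s ^ 6 - a ^ 2 := Real.sq_sqrt (by rw [hQ]; nlinarith)
  have hR2s : R ≤ 2 * s := by
    have : 0 < 1 / s ^ 2 := by positivity
    exact abs_le_of_sq_le_sq' (by nlinarith) (by linarith) |>.2
  have hRp : 0 < R := by linarith
  have hua : u a ^ 2 ≤ 18 / s := by
    rw [le_div_iff₀ hs0]
    have : 0 ≤ v a ^ 2 / R := by positivity
    nlinarith [sq_nonneg (u a)]
  let F : ℝ → ℝ := fun y => v y ^ 2 + (s ^ 6 - y ^ 2) * u y ^ 2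
  have hFa : F a ≤ 36 * s := by
    have : F a = R * (R * u a ^ 2 + v a ^ 2 / R) := by
      simp only [F, ← hR2]; field_simp; ring
    rw [this]
    calc _ ≤ R * 18 := by gcongr
      _ ≤ _ := by linarith
  have hFd : ∀ y, HasDerivAt F (-(2 * y * u y ^ 2)) y := by
    intro y
    have h1 : HasDerivAt (fun y : ℝ => s ^ 6 - y ^ 2) (-(2 * y)) y := by
      simpa using (hasDerivAt_pow 2 y).const_sub (s ^ 6)
    refine (((hv y).pow 2).add (h1.mul ((hu y).pow 2))).congr_deriv ?_
    simp only [Pi.pow_apply]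
    ring
  have hanti : AntitoneOn F (Set.Ici 0) := by
    refine antitoneOn_of_deriv_nonpos (convex_Ici _)
      (fun y _ => (hFd y).continuousAt.continuousWithinAt)
      (fun y _ => (hFd y).differentiableAt.differentiableWithinAt) (fun y hy => ?_)
    rw [interior_Ici] at hy
    rw [(hFd y).deriv, neg_nonpos]
    have := Set.mem_Ioi.1 hy
    positivity
  have hvb : ∀ y ∈ Set.Icc a (s ^ 3), ‖v y‖ ≤ 6 * √s := by
    intro y hy
    have h1 := hanti (Set.mem_Ici.2 ha0) (Set.mem_Ici.2 (ha0.trans hy.1)) hy.1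
    have h2 : 0 ≤ (s ^ 6 - y ^ 2) * u y ^ 2 := by
      have : y ^ 2 ≤ (s ^ 3) ^ 2 := by
        have := ha0.trans hy.1
        have := hy.2
        gcongr
      have : 0 ≤ s ^ 6 - y ^ 2 := by nlinarith
      positivity
    refine abs_le_of_sq_le_sq ?_ (by positivity)
    rw [mul_pow, Real.sq_sqrt hs0.le]
    simp only [F] at h1 hFa
    linarith
  have hmv := (convex_Icc a (s ^ 3)).norm_image_sub_le_of_norm_hasDerivWithin_le
    (fun y _ => (hu y).hasDerivWithinAt) hvb (Set.left_mem_Icc.2 (hx1.trans hx)) ⟨hx1, hx⟩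
  set t := √s with ht
  have ht0 : 0 < t := Real.sqrt_pos.2 hs0
  have hts : t ^ 2 = s := Real.sq_sqrt hs0.le
  have hd : ‖u x - u a‖ ≤ 6 / t := by
    refine hmv.trans ?_
    have : ‖x - a‖ ≤ 1 / s := by
      rw [Real.norm_eq_abs, abs_of_nonneg (by linarith)]
      linarith
    calc 6 * t * ‖x - a‖ ≤ 6 * t * (1 / s) := by gcongr
      _ = 6 / t := by rw [← hts]; field_simp
  have hua' : |u a| ≤ 5 / t := by
    refine abs_le_of_sq_le_sq ?_ (by positivity)
    rw [div_pow, hts]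
    exact hua.trans (by gcongr; norm_num)
  have hux : |u x| ≤ 11 / t := by
    have h1 : |u x| ≤ |u x - u a| + |u a| := by
      simpa using abs_add_le (u x - u a) (u a)
    rw [Real.norm_eq_abs] at hd
    calc _ ≤ 6 / t + 5 / t := by linarith
      _ = _ := by ring
  calc u x ^ 2 = |u x| ^ 2 := (sq_abs _).symm
    _ ≤ (11 / t) ^ 2 := by gcongr
    _ = _ := by rw [div_pow, hts]; norm_num

theorem oscillator_oscillatory_bound (hs : 1 ≤ s)
    (hu : ∀ x, HasDerivAt u (v x) x) (hv : ∀ x, HasDerivAt v ((x ^ 2 - s ^ 6) * u x) x)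
    (h0 : s ^ 3 * u 0 ^ 2 + v 0 ^ 2 / s ^ 3 ≤ 3) {x : ℝ} (hx0 : 0 ≤ x) (hx : x ≤ s ^ 3) :
    u x ^ 4 * s ^ 2 * (1 + s * (s ^ 3 - x)) ≤ 1000 ^ 2 := by
  have hs0 : 0 < s := by linarith
  rcases le_total x (s ^ 3 - 1 / s) with h | h
  · have hG := oscillator_energy_bound hs hu hv h0 hx0 h
    have h1 : 1 ≤ s * (s ^ 3 - x) := by
      have : 1 / s ≤ s ^ 3 - x := by linarith
      rwa [div_le_iff₀' hs0] at this
    have h2 : s ^ 2 * (s * (s ^ 3 - x)) ≤ s ^ 6 - x ^ 2 := by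
      have : 0 ≤ s ^ 3 - x := by linarith
      nlinarith
    have hQ : 0 < s ^ 6 - x ^ 2 := by nlinarith [pow_pos hs0 2]
    have hR2 : √(s ^ 6 - x ^ 2) ^ 2 = s ^ 6 - x ^ 2 := Real.sq_sqrt hQ.le
    have hRp : 0 < √(s ^ 6 - x ^ 2) := Real.sqrt_pos.2 hQ
    set R := √(s ^ 6 - x ^ 2)
    have h3 : R * u x ^ 2 ≤ 18 := by
      have : 0 ≤ v x ^ 2 / R := by positivity
      linarith
    have h4 : (R * u x ^ 2) ^ 2 ≤ 18 ^ 2 := by gcongr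
    calc u x ^ 4 * s ^ 2 * (1 + s * (s ^ 3 - x))
        ≤ u x ^ 4 * s ^ 2 * (2 * (s * (s ^ 3 - x))) := by gcongr; linarith
      _ = 2 * u x ^ 4 * (s ^ 2 * (s * (s ^ 3 - x))) := by ring
      _ ≤ 2 * u x ^ 4 * (s ^ 6 - x ^ 2) := by gcongr
      _ = 2 * (R * u x ^ 2) ^ 2 := by rw [← hR2]; ring
      _ ≤ _ := by linarith
  · have h1 := oscillator_transition_bound hs hu hv h0 h hx
    have h2 : s * (s ^ 3 - x) ≤ 1 := by
      have : s ^ 3 - x ≤ 1 / s := by linarith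
      rwa [le_div_iff₀' hs0] at this
    rw [le_div_iff₀ hs0] at h1
    have h3 : (u x ^ 2 * s) ^ 2 ≤ 121 ^ 2 := by gcongr
    calc u x ^ 4 * s ^ 2 * (1 + s * (s ^ 3 - x)) ≤ u x ^ 4 * s ^ 2 * 2 := by gcongr; linarith
      _ = (u x ^ 2 * s) ^ 2 * 2 := by ring
      _ ≤ _ := by linarith

/-- Monotone quantities vanishing at infinity have a sign: `uv` increases, so `uv ≤ 0`; `v² + (s⁶ -
x²) u²` decreases, so it is nonnegative. Beyond `s³ + 1/s` one has `x² - s⁶ ≥ s²`, whence `-uv ≥ s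
u²` and `e^{2sx} u²` decreases. Before that point `u²` decreases, and inserting the exponential
costs a factor at most `e² ≤ 8`. -/
theorem oscillator_decay_bound (hs : 1 ≤ s)
    (hu : ∀ x, HasDerivAt u (v x) x) (hv : ∀ x, HasDerivAt v ((x ^ 2 - s ^ 6) * u x) x)
    (h0 : s ^ 3 * u 0 ^ 2 + v 0 ^ 2 / s ^ 3 ≤ 3)
    (hu0 : Tendsto u atTop (𝓝 0)) (hxu0 : Tendsto (fun x => x * u x) atTop (𝓝 0))
    (hv0 : Tendsto v atTop (𝓝 0)) {x : ℝ} (hx : s ^ 3 ≤ x) :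
    u x ^ 2 ≤ 1000 / s * Real.exp (-(2 * (s * (x - s ^ 3)))) := by
  have hs0 : 0 < s := by linarith
  have hT : u (s ^ 3) ^ 2 ≤ 121 / s := by
    refine oscillator_transition_bound hs hu hv h0 ?_ le_rfl
    have : 0 < 1 / s := by positivity
    linarith
  have hQ : ∀ y, s ^ 3 ≤ y → 0 ≤ y ^ 2 - s ^ 6 := by
    intro y hy
    have : (s ^ 3) ^ 2 ≤ y ^ 2 := by gcongr
    nlinarith
  have huvd : ∀ y, HasDerivAt (fun y => u y * v y) (v y ^ 2 + (y ^ 2 - s ^ 6) * u y ^ 2) y := by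
    intro y
    refine ((hu y).mul (hv y)).congr_deriv ?_
    ring
  have huv : ∀ y, s ^ 3 ≤ y → u y * v y ≤ 0 := by
    have hmono : MonotoneOn (fun y => u y * v y) (Set.Ici (s ^ 3)) := by
      refine monotoneOn_of_deriv_nonneg (convex_Ici _)
        (fun y _ => (huvd y).continuousAt.continuousWithinAt)
        (fun y _ => (huvd y).differentiableAt.differentiableWithinAt) (fun y hy => ?_)
      rw [interior_Ici] at hy
      rw [(huvd y).deriv]
      have := hQ y (Set.mem_Ioi.1 hy).le
      positivity
    intro y hy
    have hlim : Tendsto (fun y => u y * v y) atTop (𝓝 0) := by simpa using hu0.mul hv0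
    refine ge_of_tendsto hlim ?_
    filter_upwards [eventually_ge_atTop y] with z hz
    exact hmono (Set.mem_Ici.2 hy) (Set.mem_Ici.2 (hy.trans hz)) hz
  let F : ℝ → ℝ := fun y => v y ^ 2 + (s ^ 6 - y ^ 2) * u y ^ 2
  have hFd : ∀ y, HasDerivAt F (-(2 * y * u y ^ 2)) y := by
    intro y
    have h1 : HasDerivAt (fun y : ℝ => s ^ 6 - y ^ 2) (-(2 * y)) y := by
      simpa using (hasDerivAt_pow 2 y).const_sub (s ^ 6)
    refine (((hv y).pow 2).add (h1.mul ((hu y).pow 2))).congr_deriv ?_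
    simp only [Pi.pow_apply]
    ring
  have hF : ∀ y, 0 ≤ y → 0 ≤ F y := by
    have hanti : AntitoneOn F (Set.Ici 0) := by
      refine antitoneOn_of_deriv_nonpos (convex_Ici _)
        (fun y _ => (hFd y).continuousAt.continuousWithinAt)
        (fun y _ => (hFd y).differentiableAt.differentiableWithinAt) (fun y hy => ?_)
      rw [interior_Ici] at hy
      rw [(hFd y).deriv, neg_nonpos]
      have := Set.mem_Ioi.1 hy
      positivity
    intro y hy
    have hlim : Tendsto F atTop (𝓝 0) := by
      have h := ((hv0.pow 2).add ((hu0.pow 2).const_mul (s ^ 6))).sub (hxu0.pow 2)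
      simp only [ne_eq, OfNat.ofNat_ne_zero, not_false_eq_true, zero_pow, mul_zero, add_zero,
        sub_zero] at h
      refine h.congr fun z => ?_
      simp only [F]; ring
    refine le_of_tendsto hlim ?_
    filter_upwards [eventually_ge_atTop y] with z hz
    exact hanti (Set.mem_Ici.2 hy) (Set.mem_Ici.2 (hy.trans hz)) hz
  have hsq : ∀ y, HasDerivAt (fun y => u y ^ 2) (2 * (u y * v y)) y := by
    intro y
    refine ((hu y).pow 2).congr_deriv ?_
    ring
  have hanti1 : AntitoneOn (fun y => u y ^ 2) (Set.Ici (s ^ 3)) := by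
    refine antitoneOn_of_deriv_nonpos (convex_Ici _)
      (fun y _ => (hsq y).continuousAt.continuousWithinAt)
      (fun y _ => (hsq y).differentiableAt.differentiableWithinAt) (fun y hy => ?_)
    rw [interior_Ici] at hy
    rw [(hsq y).deriv]
    have := huv y (Set.mem_Ioi.1 hy).le
    linarith
  let W : ℝ → ℝ := fun y => Real.exp (2 * s * y) * u y ^ 2
  have hWd : ∀ y, HasDerivAt W (Real.exp (2 * s * y) * (2 * (s * u y ^ 2 + u y * v y))) y := by
    intro y
    have h1 : HasDerivAt (fun y => Real.exp (2 * s * y)) (Real.exp (2 * s * y) * (2 * s)) y := by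
      simpa using ((hasDerivAt_id y).const_mul (2 * s)).exp
    refine (h1.mul (hsq y)).congr_deriv ?_
    ring
  set b := s ^ 3 + 1 / s with hb
  have hb3 : s ^ 3 ≤ b := by
    have : 0 < 1 / s := by positivity
    linarith
  have hanti2 : AntitoneOn W (Set.Ici b) := by
    refine antitoneOn_of_deriv_nonpos (convex_Ici _)
      (fun y _ => (hWd y).continuousAt.continuousWithinAt)
      (fun y _ => (hWd y).differentiableAt.differentiableWithinAt) (fun y hy => ?_)
    rw [interior_Ici] at hy
    have hy' : b ≤ y := (Set.mem_Ioi.1 hy).le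
    have hy0 : 0 ≤ y := le_trans (by positivity) hy'
    rw [(hWd y).deriv]
    have h1 := huv y (hb3.trans hy')
    have h2 := hF y hy0
    have h3 : s ^ 2 ≤ y ^ 2 - s ^ 6 := by
      have h4 : b ^ 2 ≤ y ^ 2 := by gcongr
      have h5 : b ^ 2 = s ^ 6 + 2 * s ^ 2 + 1 / s ^ 2 := by rw [hb]; field_simp; ring
      have h6 : 0 < 1 / s ^ 2 := by positivity
      nlinarith
    have h4 : s * u y ^ 2 ≤ -(u y * v y) := by
      refine abs_le_of_sq_le_sq' ?_ (by linarith) |>.2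
      simp only [F] at h2
      have : s ^ 2 * u y ^ 2 ≤ v y ^ 2 := by nlinarith [sq_nonneg (u y)]
      nlinarith [sq_nonneg (u y)]
    refine mul_nonpos_of_nonneg_of_nonpos (Real.exp_pos _).le (by linarith)
  have he2 : Real.exp 2 ≤ 8 := by
    have h1 := Real.exp_one_lt_d9
    have h2 : Real.exp 2 = Real.exp 1 * Real.exp 1 := by rw [← Real.exp_add]; norm_num
    rw [h2]
    nlinarith [Real.exp_pos 1]
  have hs121 : 121 / s * 8 ≤ 1000 / s := by
    rw [div_mul_eq_mul_div]; gcongr; norm_num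
  rcases le_total x b with h | h
  · have h1 := hanti1 (Set.mem_Ici.2 le_rfl) (Set.mem_Ici.2 hx) hx
    have h2 : s * (x - s ^ 3) ≤ 1 := by
      have : x - s ^ 3 ≤ 1 / s := by linarith
      rwa [le_div_iff₀' hs0] at this
    have h3 : 1 ≤ Real.exp 2 * Real.exp (-(2 * (s * (x - s ^ 3)))) := by
      rw [← Real.exp_add]; exact Real.one_le_exp (by linarith)
    calc u x ^ 2 ≤ 121 / s * 1 := by simpa using h1.trans hT
      _ ≤ 121 / s * (8 * Real.exp (-(2 * (s * (x - s ^ 3))))) := by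
        gcongr
        refine h3.trans ?_
        gcongr
      _ = 121 / s * 8 * Real.exp (-(2 * (s * (x - s ^ 3)))) := by ring
      _ ≤ _ := by gcongr
  · have h1 := hanti1 (Set.mem_Ici.2 le_rfl) (Set.mem_Ici.2 hb3) hb3
    have h2 := hanti2 (Set.mem_Ici.2 le_rfl) (Set.mem_Ici.2 h) h
    have h3 : u x ^ 2 ≤ Real.exp (2 * s * (b - x)) * u b ^ 2 := by
      have : Real.exp (2 * s * (b - x)) = Real.exp (2 * s * b) * Real.exp (-(2 * s * x)) := by
        rw [← Real.exp_add]; ring_nf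
      rw [this]
      have h4 : u x ^ 2 = W x * Real.exp (-(2 * s * x)) := by
        simp only [W]
        rw [mul_right_comm, ← Real.exp_add]; simp
      rw [h4, mul_right_comm (Real.exp (2 * s * b))]
      exact mul_le_mul_of_nonneg_right h2 (Real.exp_pos _).le
    have h5 : Real.exp (2 * s * (b - x)) = Real.exp 2 * Real.exp (-(2 * (s * (x - s ^ 3)))) := by
      rw [← Real.exp_add, hb]
      congr 1
      field_simp
      ring
    calc u x ^ 2 ≤ Real.exp (2 * s * (b - x)) * u b ^ 2 := h3
      _ ≤ (8 * Real.exp (-(2 * (s * (x - s ^ 3))))) * (121 / s) := by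
        rw [h5]
        gcongr
        exact h1.trans hT
      _ = 121 / s * 8 * Real.exp (-(2 * (s * (x - s ^ 3)))) := by ring
      _ ≤ _ := by gcongr

end OscillatorODE

/-! ### Pointwise bounds for Hermite functions in the turning-point scale. -/

/-- The sixth root of the eigenvalue `2k + 1`: the turning points of `hermiteFn k` are
`± hermiteScale k ^ 3`, and the transition region around them has width `1 / hermiteScale k`. -/
noncomputable def hermiteScale (k : ℕ) : ℝ := (2 * k + 1 : ℝ) ^ (1 / 6 : ℝ)

theorem one_le_hermiteScale (k : ℕ) : 1 ≤ hermiteScale k :=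
  Real.one_le_rpow (by linarith [Nat.cast_nonneg (α := ℝ) k]) (by norm_num)

theorem hermiteScale_pow_six (k : ℕ) : hermiteScale k ^ 6 = 2 * k + 1 := by
  rw [hermiteScale, ← Real.rpow_natCast, ← Real.rpow_mul (by positivity)]
  norm_num

theorem tendsto_hermiteScale : Tendsto hermiteScale atTop atTop := by
  refine (tendsto_rpow_atTop (by norm_num)).comp ?_
  exact tendsto_atTop_add_const_right _ _
    (tendsto_natCast_atTop_atTop.const_mul_atTop (by norm_num))

/-- Since `h_k'(0) = √(2k) h_{k-1}(0)`, both summands are governed by `hermiteFn_zero_pow_four`; the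
square of each is at most `2 < (3/2)²`. -/
theorem hermiteFn_energy_zero (k : ℕ) :
    hermiteScale k ^ 3 * hermiteFn k 0 ^ 2 + hermiteFnDeriv k 0 ^ 2 / hermiteScale k ^ 3 ≤ 3 := by
  have hs := one_le_hermiteScale k
  have h6 := hermiteScale_pow_six k
  set s := hermiteScale k
  have h1 : s ^ 3 * hermiteFn k 0 ^ 2 ≤ 3 / 2 := by
    refine abs_le_of_sq_le_sq' ?_ (by norm_num) |>.2
    have := hermiteFn_zero_pow_four k
    have h4 : 0 ≤ hermiteFn k 0 ^ 4 := by positivity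
    calc (s ^ 3 * hermiteFn k 0 ^ 2) ^ 2 = s ^ 6 * hermiteFn k 0 ^ 4 := by ring
      _ ≤ _ := by rw [h6]; nlinarith
  have h2 : hermiteFnDeriv k 0 ^ 2 / s ^ 3 ≤ 3 / 2 := by
    refine abs_le_of_sq_le_sq' ?_ (by norm_num) |>.2
    rw [div_pow, div_le_iff₀ (by positivity), ← pow_mul, ← pow_mul]
    norm_num
    rw [h6]
    cases k with
    | zero => norm_num [hermiteFnDeriv]
    | succ k =>
      have := hermiteFn_zero_pow_four k
      have h4 : √(2 * (k + 1 : ℝ)) ^ 4 = (2 * (k + 1)) ^ 2 := by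
        rw [show √(2 * (k + 1 : ℝ)) ^ 4 = (√(2 * (k + 1 : ℝ)) ^ 2) ^ 2 by ring,
          Real.sq_sqrt (by positivity)]
      simp only [hermiteFnDeriv, Nat.add_sub_cancel, zero_mul, sub_zero, mul_pow]
      push_cast
      rw [h4]
      have hk : (0 : ℝ) ≤ k := Nat.cast_nonneg k
      nlinarith
  linarith

theorem abs_hermiteFn_abs (k : ℕ) (x : ℝ) : |hermiteFn k (|x|)| = |hermiteFn k x| := by
  rcases abs_choice x with h | h <;> rw [h]
  rw [hermiteFn_neg, abs_mul, abs_pow, abs_neg, abs_one, one_pow, one_mul]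

theorem hermiteFn_oscillatory_bound (k : ℕ) {x : ℝ} (hx : |x| ≤ hermiteScale k ^ 3) :
    hermiteFn k x ^ 4 * hermiteScale k ^ 2 *
      (1 + hermiteScale k * (hermiteScale k ^ 3 - |x|)) ≤ 1000 ^ 2 := by
  have h := oscillator_oscillatory_bound (one_le_hermiteScale k) (hasDerivAt_hermiteFn k)
    (fun x => by rw [hermiteScale_pow_six]; exact hasDerivAt_hermiteFnDeriv k x)
    (hermiteFn_energy_zero k) (abs_nonneg x) hx
  have h4 : Even 4 := ⟨2, rfl⟩
  rwa [← h4.pow_abs, abs_hermiteFn_abs, h4.pow_abs] at h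

theorem hermiteFn_decay_bound (k : ℕ) {x : ℝ} (hx : hermiteScale k ^ 3 ≤ |x|) :
    hermiteFn k x ^ 2 ≤ 1000 / hermiteScale k *
      Real.exp (-(2 * (hermiteScale k * (|x| - hermiteScale k ^ 3)))) := by
  have h := oscillator_decay_bound (one_le_hermiteScale k) (hasDerivAt_hermiteFn k)
    (fun x => by rw [hermiteScale_pow_six]; exact hasDerivAt_hermiteFnDeriv k x)
    (hermiteFn_energy_zero k) (tendsto_hermiteFn k) (tendsto_id_mul_hermiteFn k)
    (tendsto_hermiteFnDeriv k) hx
  rwa [← sq_abs, abs_hermiteFn_abs, sq_abs] at h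

/-- The profile of `|hermiteFn k|` in the rescaled distance to the turning points. -/
noncomputable def hermiteProfile (S z : ℝ) : ℝ :=
  if z < 0 then Real.exp (z / 2) else if z ≤ S then (1 + z) ^ (-(1 / 4) : ℝ) else 0

theorem hermiteProfile_nonneg (S z : ℝ) : 0 ≤ hermiteProfile S z := by
  unfold hermiteProfile
  split_ifs with h
  · positivity
  · have : 0 ≤ z := not_lt.1 h
    positivity
  · exact le_rfl

theorem hermiteProfile_le_one (S z : ℝ) : hermiteProfile S z ≤ 1 := by
  unfold hermiteProfile
  split_ifs
  · exact Real.exp_le_one_iff.2 (by linarith)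
  · exact Real.rpow_le_one_of_one_le_of_nonpos (by linarith) (by norm_num)
  · norm_num

theorem measurable_hermiteProfile (S : ℝ) : Measurable (hermiteProfile S) := by
  unfold hermiteProfile
  refine Measurable.ite measurableSet_Iio (by fun_prop) ?_
  exact Measurable.ite measurableSet_Iic (by fun_prop) measurable_const

/-- Between the turning points the weight is at most `2 s^{3α}`. Outside, `|x| ≤ s³ e^{-z}`, so it
costs a further `e^{-αz}`, which half of the decay `e^z` absorbs; this is why the profile has
`e^{z/2}`. Its cutoff `S = s⁴` is the value of `z` at `x = 0`. -/
theorem weighted_hermiteFn_le {α : ℝ} (hα0 : 0 ≤ α) (hα : α ≤ 1 / 4) (k : ℕ) (x : ℝ) :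
    (1 + x ^ 2) ^ (α / 2) * |hermiteFn k x| ≤
      64 * hermiteScale k ^ (3 * α - 1 / 2) *
        hermiteProfile (hermiteScale k ^ 4) (hermiteScale k * (hermiteScale k ^ 3 - |x|)) := by
  have hs := one_le_hermiteScale k
  have hosc := hermiteFn_oscillatory_bound k (x := x)
  have hdec := hermiteFn_decay_bound k (x := x)
  set s := hermiteScale k
  have hs0 : 0 < s := by linarith
  have h2α : (2 : ℝ) ^ α ≤ 2 := by
    calc (2 : ℝ) ^ α ≤ 2 ^ (1 : ℝ) := Real.rpow_le_rpow_of_exponent_le (by norm_num) (by linarith)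
      _ = 2 := by simp
  have hsplit : s ^ (3 * α - 1 / 2) = s ^ (3 * α) * s ^ (-(1 / 2) : ℝ) := by
    rw [← Real.rpow_add hs0]; ring_nf
  have hs3α : (s ^ 3) ^ α = s ^ (3 * α) := by
    rw [← Real.rpow_natCast, ← Real.rpow_mul hs0.le]; norm_num
  have hhalf : (s ^ (-(1 / 2) : ℝ)) ^ 2 = 1 / s := by
    rw [← Real.rpow_natCast, ← Real.rpow_mul hs0.le]; norm_num [Real.rpow_neg_one]
  have hweight : ∀ y : ℝ, 0 ≤ y → (1 + x ^ 2) ≤ (2 * s ^ 3 * y) ^ 2 →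
      (1 + x ^ 2) ^ (α / 2) ≤ 2 * s ^ (3 * α) * y ^ α := by
    intro y hy h
    calc (1 + x ^ 2) ^ (α / 2) ≤ ((2 * s ^ 3 * y) ^ 2) ^ (α / 2) := by gcongr
      _ = (2 * s ^ 3 * y) ^ α := by
        rw [← Real.rpow_natCast, ← Real.rpow_mul (by positivity)]
        congr 1
        push_cast
        ring
      _ = 2 ^ α * s ^ (3 * α) * y ^ α := by
        rw [Real.mul_rpow (by positivity) hy, Real.mul_rpow (by norm_num) (by positivity), hs3α]
      _ ≤ _ := by gcongr
  have hs6 : 1 ≤ s ^ 6 := one_le_pow₀ hs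
  rcases le_or_gt |x| (s ^ 3) with h | h
  · have hz0 : 0 ≤ s * (s ^ 3 - |x|) := mul_nonneg hs0.le (by linarith)
    have hzS : s * (s ^ 3 - |x|) ≤ s ^ 4 := by nlinarith [abs_nonneg x]
    rw [hermiteProfile, if_neg (not_lt.2 hz0), if_pos hzS]
    have hosc := hosc h
    set z := s * (s ^ 3 - |x|)
    have hquart : ((1 + z) ^ (-(1 / 4) : ℝ)) ^ 4 = 1 / (1 + z) := by
      rw [← Real.rpow_natCast, ← Real.rpow_mul (by positivity)]; norm_num [Real.rpow_neg_one]
    -- The constant 32 serves both regions: `32⁴ ≥ 1000²` here and `32² ≥ 1000` in the exponential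
    -- region.
    have h1 : |hermiteFn k x| ≤ 32 * s ^ (-(1 / 2) : ℝ) * (1 + z) ^ (-(1 / 4) : ℝ) := by
      refine le_of_pow_le_pow_left₀ (by norm_num : 4 ≠ 0) (by positivity) ?_
      rw [mul_pow, mul_pow, hquart,
        show (s ^ (-(1 / 2) : ℝ)) ^ 4 = ((s ^ (-(1 / 2) : ℝ)) ^ 2) ^ 2 by ring, hhalf,
        Even.pow_abs (n := 4) ⟨2, rfl⟩]
      rw [show (32 : ℝ) ^ 4 * (1 / s) ^ 2 * (1 / (1 + z)) = 32 ^ 4 / (s ^ 2 * (1 + z)) by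
        field_simp, le_div_iff₀ (by positivity), ← mul_assoc]
      linarith
    have h2 := hweight 1 zero_le_one (by
      have : x ^ 2 ≤ (s ^ 3) ^ 2 := by rw [← sq_abs]; gcongr
      nlinarith)
    rw [Real.one_rpow, mul_one] at h2
    calc _ ≤ 2 * s ^ (3 * α) * (32 * s ^ (-(1 / 2) : ℝ) * (1 + z) ^ (-(1 / 4) : ℝ)) := by gcongr
      _ = _ := by rw [hsplit]; ring
  · have hz0 : s * (s ^ 3 - |x|) < 0 := mul_neg_of_pos_of_neg hs0 (by linarith)
    rw [hermiteProfile, if_pos hz0]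
    have hdec := hdec h.le
    rw [show -(2 * (s * (|x| - s ^ 3))) = 2 * (s * (s ^ 3 - |x|)) by ring] at hdec
    obtain ⟨z, hz⟩ : ∃ z, z = s * (s ^ 3 - |x|) := ⟨_, rfl⟩
    rw [← hz] at hdec hz0 ⊢
    have h1 : |hermiteFn k x| ≤ 32 * s ^ (-(1 / 2) : ℝ) * Real.exp z := by
      refine le_of_pow_le_pow_left₀ (by norm_num : 2 ≠ 0) (by positivity) ?_
      rw [sq_abs, mul_pow, mul_pow, hhalf, ← Real.exp_nat_mul]
      refine hdec.trans ?_
      push_cast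
      rw [mul_one_div]
      gcongr
      norm_num
    have h2 := hweight (Real.exp (-z)) (Real.exp_pos _).le (by
      have hx : |x| ≤ s ^ 3 * Real.exp (-z) := by
        have h3 : 1 - z ≤ Real.exp (-z) := by linarith [Real.add_one_le_exp (-z)]
        have h4 : |x| ≤ s ^ 3 * (1 - z) := by
          have h5 : |x| - s ^ 3 ≤ s ^ 4 * (|x| - s ^ 3) :=
            le_mul_of_one_le_left (by linarith) (one_le_pow₀ hs)
          rw [hz]
          linarith
        exact h4.trans (by gcongr)
      have h5 : 1 ≤ s ^ 3 * Real.exp (-z) :=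
        one_le_mul_of_one_le_of_one_le (one_le_pow₀ hs) (Real.one_le_exp (by linarith))
      have h6 : x ^ 2 ≤ (s ^ 3 * Real.exp (-z)) ^ 2 := by rw [← sq_abs]; gcongr
      nlinarith)
    have h3 : Real.exp (-z) ^ α * Real.exp z ≤ Real.exp (z / 2) := by
      rw [← Real.exp_mul, ← Real.exp_add]
      exact Real.exp_le_exp.2 (by nlinarith)
    calc _ ≤ 2 * s ^ (3 * α) * Real.exp (-z) ^ α * (32 * s ^ (-(1 / 2) : ℝ) * Real.exp z) := by
            gcongr
      _ = 64 * (s ^ (3 * α) * s ^ (-(1 / 2) : ℝ)) * (Real.exp (-z) ^ α * Real.exp z) := by ring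
      _ ≤ _ := by rw [hsplit]; gcongr

theorem abs_hermiteFn_le (k : ℕ) (x : ℝ) :
    |hermiteFn k x| ≤ 64 * hermiteScale k ^ (-(1 / 2) : ℝ) := by
  have h := weighted_hermiteFn_le le_rfl (by norm_num : (0 : ℝ) ≤ 1 / 4) k x
  norm_num at h
  refine h.trans ?_
  have hs : 0 ≤ hermiteScale k := zero_le_one.trans (one_le_hermiteScale k)
  rw [show (-(1 / 2) : ℝ) = -1 / 2 by norm_num]
  exact mul_le_of_le_one_right (by positivity) (hermiteProfile_le_one _ _)

/-! ### Uniform `L^q` bounds for weighted Hermite functions. -/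

theorem lintegral_comp_turning_point {g : ℝ → ℝ≥0∞} (hg : Measurable g) {s : ℝ} (hs : 0 < s)
    (a : ℝ) : ∫⁻ x, g (s * (a - |x|)) ≤ ENNReal.ofReal (2 / s) * ∫⁻ z, g z := by
  have hscale : ∫⁻ x, g (s * x) = ENNReal.ofReal s⁻¹ * ∫⁻ z, g z := by
    rw [← lintegral_map (f := g) hg (measurable_const_mul s), Real.map_volume_mul_left hs.ne',
      lintegral_smul_measure, abs_of_pos (inv_pos.2 hs), smul_eq_mul]
  have h1 : ∫⁻ x, g (s * (a - x)) = ∫⁻ x, g (s * x) :=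
    lintegral_sub_left_eq_self (fun x => g (s * x)) a
  have h2 : ∫⁻ x, g (s * (a + x)) = ∫⁻ x, g (s * x) :=
    lintegral_add_left_eq_self (fun x => g (s * x)) a
  calc ∫⁻ x, g (s * (a - |x|)) ≤ ∫⁻ x, g (s * (a - x)) + g (s * (a + x)) := by
        refine lintegral_mono fun x => ?_
        rcases abs_choice x with h | h <;> simp [h]
    _ = ENNReal.ofReal s⁻¹ * (∫⁻ z, g z) + ENNReal.ofReal s⁻¹ * (∫⁻ z, g z) := by
        rw [lintegral_add_left (by fun_prop), h1, h2, hscale]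
    _ = _ := by
        rw [← add_mul, ← ENNReal.ofReal_add (by positivity) (by positivity)]
        congr 2
        ring

/-- The exponential part is integrable on its own, and so is `(1 + z)^{-q/4}` when `q > 4`.
Otherwise `-q/4 ≤ β - 1`, and the integral of `(1 + z)^{β-1}` up to `S` is `O(S^β)`; taking `β > 0`
also covers the logarithm at `q = 4`. -/
theorem lintegral_hermiteProfile_le {q β : ℝ} (hq : 0 < q) (hβ0 : 0 ≤ β)
    (hβ : 4 < q ∨ (0 < β ∧ 1 - q / 4 ≤ β)) :
    ∃ M : ℝ≥0∞, M ≠ ∞ ∧ ∀ S : ℝ, 1 ≤ S →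
      ENNReal.ofReal (S ^ (-β)) * ∫⁻ z, ENNReal.ofReal (hermiteProfile S z ^ q) ≤ M := by
  let A : ℝ≥0∞ := ∫⁻ z in Set.Iio 0, ENNReal.ofReal (Real.exp (q / 2 * z))
  have hA : A ≠ ∞ := by
    have : IntegrableOn (fun z => Real.exp (q / 2 * z)) (Set.Iio 0) :=
      (integrableOn_exp_mul_Iic (by positivity) 0).mono_set Set.Iio_subset_Iic_self
    exact this.lintegral_lt_top.ne
  have hsplit : ∀ S : ℝ, 1 ≤ S → ∫⁻ z, ENNReal.ofReal (hermiteProfile S z ^ q) ≤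
      A + ∫⁻ z in Set.Icc 0 S, ENNReal.ofReal ((1 + z) ^ (-(q / 4))) := by
    intro S hS
    change _ ≤ (∫⁻ z in Set.Iio 0, ENNReal.ofReal (Real.exp (q / 2 * z))) + _
    rw [← lintegral_indicator measurableSet_Iio, ← lintegral_indicator measurableSet_Icc,
      ← lintegral_add_left (by
        exact Measurable.indicator (by fun_prop) measurableSet_Iio)]
    refine lintegral_mono fun z => ?_
    simp only [Set.indicator, Set.mem_Iio, Set.mem_Icc]
    unfold hermiteProfile
    by_cases h1 : z < 0
    · rw [if_pos h1, if_pos h1, ← Real.exp_mul]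
      refine le_add_right (le_of_eq ?_)
      ring_nf
    · rw [if_neg h1, if_neg h1]
      by_cases h2 : z ≤ S
      · rw [if_pos h2, if_pos ⟨not_lt.1 h1, h2⟩, ← Real.rpow_mul (by linarith), zero_add]
        refine le_of_eq ?_
        ring_nf
      · rw [if_neg h2, Real.zero_rpow hq.ne']
        simp
  have hSβ : ∀ S : ℝ, 1 ≤ S → ENNReal.ofReal (S ^ (-β)) ≤ 1 := fun S hS => by
    rw [← ENNReal.ofReal_one]
    exact ENNReal.ofReal_le_ofReal (Real.rpow_le_one_of_one_le_of_nonpos hS (by linarith))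
  rcases hβ with h4 | ⟨hβ1, hβ2⟩
  · let B : ℝ≥0∞ := ∫⁻ z : ℝ, ENNReal.ofReal ((1 + ‖z‖) ^ (-(q / 4)))
    have hB : B ≠ ∞ := by
      have : Integrable (fun z : ℝ => (1 + ‖z‖) ^ (-(q / 4))) := by
        refine integrable_one_add_norm ?_
        simp
        linarith
      exact this.lintegral_lt_top.ne
    refine ⟨A + B, ENNReal.add_ne_top.2 ⟨hA, hB⟩, fun S hS => ?_⟩
    refine (mul_le_of_le_one_left' (hSβ S hS)).trans ((hsplit S hS).trans ?_)
    gcongr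
    refine le_trans (setLIntegral_mono' measurableSet_Icc fun z hz => ?_)
      (setLIntegral_le_lintegral (Set.Icc 0 S) _)
    rw [Real.norm_of_nonneg hz.1]
  · refine ⟨A + ENNReal.ofReal (2 ^ β / β), ENNReal.add_ne_top.2 ⟨hA, ENNReal.ofReal_ne_top⟩,
      fun S hS => ?_⟩
    have hS0 : 0 < S := by linarith
    have hint : ∫⁻ z in Set.Icc 0 S, ENNReal.ofReal ((1 + z) ^ (-(q / 4))) ≤
        ENNReal.ofReal ((1 + S) ^ β / β) := by
      have hcont : ContinuousOn (fun z : ℝ => (1 + z) ^ (β - 1)) (Set.Icc 0 S) := by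
        refine ContinuousOn.rpow_const (by fun_prop) fun z hz => Or.inl ?_
        have := hz.1
        positivity
      calc _ ≤ ∫⁻ z in Set.Icc 0 S, ENNReal.ofReal ((1 + z) ^ (β - 1)) := by
            refine setLIntegral_mono' measurableSet_Icc fun z hz => ENNReal.ofReal_le_ofReal ?_
            exact Real.rpow_le_rpow_of_exponent_le (by linarith [hz.1]) (by linarith)
        _ = ENNReal.ofReal (∫ z in Set.Icc 0 S, (1 + z) ^ (β - 1)) := by
            rw [ofReal_integral_eq_lintegral_ofReal (hcont.integrableOn_Icc)]
            refine (ae_restrict_iff' measurableSet_Icc).2 (Eventually.of_forall fun z hz => ?_)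
            have := hz.1
            positivity
        _ ≤ _ := by
            refine ENNReal.ofReal_le_ofReal ?_
            rw [integral_Icc_eq_integral_Ioc, ← intervalIntegral.integral_of_le hS0.le,
              intervalIntegral.integral_comp_add_left (fun t : ℝ => t ^ (β - 1)) 1,
              integral_rpow (Or.inl (by linarith))]
            simp only [sub_add_cancel, add_zero, Real.one_rpow]
            gcongr
            linarith
    calc _ ≤ ENNReal.ofReal (S ^ (-β)) * (A + ENNReal.ofReal ((1 + S) ^ β / β)) := by
          gcongr
          exact (hsplit S hS).trans (by gcongr)
      _ ≤ A + ENNReal.ofReal (S ^ (-β)) * ENNReal.ofReal ((1 + S) ^ β / β) := by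
          rw [mul_add]
          gcongr
          exact mul_le_of_le_one_left' (hSβ S hS)
      _ ≤ _ := by
          gcongr
          rw [← ENNReal.ofReal_mul (by positivity)]
          refine ENNReal.ofReal_le_ofReal ?_
          rw [← mul_div_assoc]
          gcongr
          calc S ^ (-β) * (1 + S) ^ β ≤ S ^ (-β) * (2 * S) ^ β := by gcongr; linarith
            _ = 2 ^ β := by
              rw [Real.mul_rpow (by norm_num) hS0.le, mul_left_comm, ← Real.rpow_add hS0]
              simp

theorem eLpNorm_weighted_hermiteFn_le {q α : ℝ} (hq : 0 < q) (hα0 : 0 ≤ α) (hα : α ≤ 1 / 4)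
    (h0 : 3 * q * α ≤ 1 + q / 2)
    (h1 : 4 < q ∨ (3 * q * α < 1 + q / 2 ∧ 3 * q * α ≤ 3 * q / 2 - 3)) :
    ∃ M : ℝ≥0∞, M ≠ ∞ ∧ ∀ k, eLpNorm (fun x => (1 + x ^ 2) ^ (α / 2) * hermiteFn k x)
      (ENNReal.ofReal q) volume ≤ M := by
  -- Chosen so that `(s⁴)^{-β}` is the total power of `s`: `s^{(3α - 1/2)q}` from the pointwise
  -- bound and `s^{-1}` from rescaling.
  set β : ℝ := (1 + q / 2 - 3 * q * α) / 4 with hβ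
  obtain ⟨M, hM, hMS⟩ := lintegral_hermiteProfile_le (q := q) (β := β) hq (by linarith)
    (h1.imp id fun h => ⟨by linarith [h.1], by linarith [h.2]⟩)
  refine ⟨(ENNReal.ofReal (64 ^ q * 2) * M) ^ (1 / q), ?_, fun k => ?_⟩
  · exact ENNReal.rpow_ne_top_of_nonneg (by positivity) (ENNReal.mul_ne_top ENNReal.ofReal_ne_top hM)
  have hs := one_le_hermiteScale k
  have hbd := weighted_hermiteFn_le hα0 hα k
  set s := hermiteScale k
  have hs0 : 0 < s := by linarith
  rw [eLpNorm_eq_lintegral_rpow_enorm_toReal (by simpa using hq) ENNReal.ofReal_ne_top,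
    ENNReal.toReal_ofReal hq.le]
  gcongr
  calc ∫⁻ x, ‖(1 + x ^ 2) ^ (α / 2) * hermiteFn k x‖ₑ ^ q
      ≤ ∫⁻ x, ENNReal.ofReal ((64 * s ^ (3 * α - 1 / 2)) ^ q) *
          ENNReal.ofReal (hermiteProfile (s ^ 4) (s * (s ^ 3 - |x|)) ^ q) := by
        refine lintegral_mono fun x => ?_
        rw [← ENNReal.ofReal_mul (by positivity),
          ← Real.mul_rpow (by positivity) (hermiteProfile_nonneg _ _), ← ofReal_norm,
          ENNReal.ofReal_rpow_of_nonneg (norm_nonneg _) hq.le]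
        refine ENNReal.ofReal_le_ofReal (Real.rpow_le_rpow (norm_nonneg _) ?_ hq.le)
        rw [norm_mul, Real.norm_of_nonneg (by positivity)]
        exact hbd x
    _ ≤ ENNReal.ofReal ((64 * s ^ (3 * α - 1 / 2)) ^ q) * (ENNReal.ofReal (2 / s) *
          ∫⁻ z, ENNReal.ofReal (hermiteProfile (s ^ 4) z ^ q)) := by
        rw [lintegral_const_mul' _ _ ENNReal.ofReal_ne_top]
        gcongr
        have := measurable_hermiteProfile (s ^ 4)
        exact lintegral_comp_turning_point
          (g := fun z => ENNReal.ofReal (hermiteProfile (s ^ 4) z ^ q)) (by fun_prop) hs0 _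
    _ = ENNReal.ofReal (64 ^ q * 2) * (ENNReal.ofReal ((s ^ 4) ^ (-β)) *
          ∫⁻ z, ENNReal.ofReal (hermiteProfile (s ^ 4) z ^ q)) := by
        rw [← mul_assoc, ← mul_assoc, ← ENNReal.ofReal_mul (by positivity),
          ← ENNReal.ofReal_mul (by positivity)]
        congr 2
        rw [Real.mul_rpow (by norm_num) (by positivity), ← Real.rpow_mul hs0.le,
          show (s ^ 4 : ℝ) = s ^ (4 : ℝ) by norm_cast, ← Real.rpow_mul hs0.le,
          show 4 * -β = (3 * α - 1 / 2) * q - 1 by rw [hβ]; ring, Real.rpow_sub_one hs0.ne']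
        ring
    _ ≤ _ := by
        gcongr
        exact hMS _ (one_le_pow₀ hs)

/-! ### Convergence of the Hermite norms to zero, by approximation in `L²`. -/

theorem tExp_neg {p : ℝ} (hp : 2 ≤ p) : tExp p < 0 := by
  unfold tExp
  have h1 : 0 < 1 / p := by positivity
  have h2 : 1 / p ≤ 1 / 2 := by gcongr
  split_ifs
  · have : 2 / p = 2 * (1 / p) := by ring
    linarith
  · have : 1 / (2 * p) = 1 / p / 2 := by ring
    linarith

theorem tendsto_hermiteFn_sup_bound :
    Tendsto (fun k => ENNReal.ofReal (64 * hermiteScale k ^ (-(1 / 2) : ℝ))) atTop (𝓝 0) := by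
  have h := ((tendsto_rpow_neg_atTop (by norm_num : (0 : ℝ) < 1 / 2)).comp
    tendsto_hermiteScale).const_mul 64
  rw [mul_zero] at h
  rw [← ENNReal.ofReal_zero]
  exact ENNReal.tendsto_ofReal h

theorem eLpNorm_mul_hermiteFn_le (k : ℕ) (g : ℝ → ℂ) :
    eLpNorm (fun x => g x * (hermiteFn k x : ℂ)) 2 volume ≤
      ENNReal.ofReal (64 * hermiteScale k ^ (-(1 / 2) : ℝ)) * eLpNorm g 2 volume := by
  have h := eLpNorm_le_mul_eLpNorm_of_ae_le_mul (μ := volume)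
    (f := fun x => g x * (hermiteFn k x : ℂ)) (g := g)
    (c := 64 * hermiteScale k ^ (-(1 / 2) : ℝ)) (Eventually.of_forall fun x => ?_) 2
  · exact h
  · rw [norm_mul, mul_comm, Complex.norm_real]
    gcongr
    exact abs_hermiteFn_le k x

theorem tendsto_eLpNorm_mul_hermiteFn {g : ℝ → ℂ} (hg : MemLp g 2 volume) :
    Tendsto (fun k => eLpNorm (fun x => g x * (hermiteFn k x : ℂ)) 2 volume) atTop (𝓝 0) := by
  have h := ENNReal.Tendsto.mul_const (b := eLpNorm g 2 volume) tendsto_hermiteFn_sup_bound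
    (Or.inr hg.eLpNorm_ne_top)
  rw [zero_mul] at h
  exact tendsto_of_tendsto_of_tendsto_of_le_of_le tendsto_const_nhds h (fun _ => zero_le)
    (fun k => eLpNorm_mul_hermiteFn_le k g)

/-- If multiplication by the Hermite functions is uniformly bounded on a seminorm and every element
can be approximated by square integrable functions, then the Hermite norms tend to zero. -/
theorem tendsto_hermiteNorm_of_approx {f : ℝ →ₘ[volume] ℂ}
    (h : ∀ ε : ℝ≥0∞, 0 < ε → ∃ g : ℝ → ℂ, MemLp g 2 volume ∧
      ∀ k, eLpNorm (fun x => (f x - g x) * (hermiteFn k x : ℂ)) 2 volume ≤ ε) :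
    Tendsto (fun k => hermiteNorm k f) atTop (𝓝 0) := by
  rw [ENNReal.tendsto_nhds_zero]
  intro ε hε
  have hε2 : 0 < ε / 2 := ENNReal.half_pos hε.ne'
  obtain ⟨g, hg, hfg⟩ := h (ε / 2) hε2
  filter_upwards [(ENNReal.tendsto_nhds_zero.1 (tendsto_eLpNorm_mul_hermiteFn hg)) _ hε2] with k hk
  have hm : AEStronglyMeasurable (fun x => (hermiteFn k x : ℂ)) volume :=
    (Complex.continuous_ofReal.comp (continuous_hermiteFn k)).aestronglyMeasurable
  have hsum : (fun x => f x * (hermiteFn k x : ℂ)) =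
      (fun x => (f x - g x) * (hermiteFn k x : ℂ)) + fun x => g x * (hermiteFn k x : ℂ) := by
    funext x
    simp only [Pi.add_apply]
    ring
  calc hermiteNorm k f ≤ _ := by
        rw [hermiteNorm, hsum]
        exact eLpNorm_add_le ((f.aestronglyMeasurable.sub hg.1).mul hm) (hg.1.mul hm)
          (by norm_num)
    _ ≤ ε / 2 + ε / 2 := add_le_add (hfg k) hk
    _ = ε := ENNReal.add_halves ε

theorem ContEmbeds.of_bound {X : Submodule ℂ (ℝ →ₘ[volume] ℂ)} {nX : (ℝ →ₘ[volume] ℂ) → ℝ≥0∞}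
    {M : ℝ≥0∞} (hM : M ≠ ∞) (hfin : ∀ f ∈ X, nX f ≠ ∞)
    (hloc : ∀ f ∈ X, ∀ K : Set ℝ, IsCompact K → MemLp f 2 (volume.restrict K))
    (hbd : ∀ f ∈ X, ∀ k, hermiteNorm k f ≤ M * nX f)
    (hlim : ∀ f ∈ X, Tendsto (fun k => hermiteNorm k f) atTop (𝓝 0)) :
    ContEmbeds X nX vSpace vNorm := by
  refine ⟨fun f hf => ⟨hloc f hf, fun k => ?_, hlim f hf⟩, M.toNNReal, fun f hf => ?_⟩
  · exact (hbd f hf k).trans_lt (ENNReal.mul_lt_top hM.lt_top (hfin f hf).lt_top)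
  · rw [ENNReal.coe_toNNReal hM]
    exact iSup_le (hbd f hf)

/-! ### The Hölder exponent and the three embeddings. -/

/-- With `q = 2p/(p-2)`, the condition on `α` is `3qα ≤ 1 + q/2` for `p < 4` (that is, `q > 4`) and
`3qα ≤ 3q/2 - 3` for `p ≥ 4`: exactly what `eLpNorm_weighted_hermiteFn_le` requires, apart from
strictness at `p = 4`. -/
theorem exists_weighted_hermiteFn_bound {p α : ℝ} (hp : 2 ≤ p) (hα : α / 2 + tExp p ≤ 0)
    (hne : (p, α) ≠ (4, 1 / 4)) :
    ∃ q : ℝ≥0∞, ENNReal.HolderTriple (ENNReal.ofReal p) q 2 ∧ ∃ M : ℝ≥0∞, M ≠ ∞ ∧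
      ∀ k, eLpNorm (fun x => (1 + x ^ 2) ^ (α / 2) * hermiteFn k x) q volume ≤ M := by
  have hp0 : 0 < p := by linarith
  -- A negative `α` only makes the weight smaller than at `α = 0`, which is admissible because `tExp
  -- p < 0`.
  wlog hα0 : 0 ≤ α generalizing α
  · obtain ⟨q, hq, M, hM, h⟩ := this (α := 0) (by linarith [tExp_neg hp])
      (fun h => by have := congrArg Prod.snd h; norm_num at this) le_rfl
    refine ⟨q, hq, M, hM, fun k => (eLpNorm_mono fun x => ?_).trans (h k)⟩
    rw [norm_mul, norm_mul, zero_div, Real.rpow_zero, norm_one]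
    gcongr
    rw [Real.norm_of_nonneg (by positivity)]
    exact Real.rpow_le_one_of_one_le_of_nonpos (by nlinarith [sq_nonneg x]) (by linarith)
  have hp1 : 1 / p ≤ 1 / 2 := by gcongr
  have hp1' : 0 < 1 / p := by positivity
  have hα14 : α ≤ 1 / 4 := by
    unfold tExp at hα
    split_ifs at hα with h4
    · have : 1 / 4 < 1 / p := by gcongr
      have : 2 / p = 2 * (1 / p) := by ring
      linarith
    · have : 1 / p ≤ 1 / 4 := by
        have := not_lt.1 h4
        gcongr
      have : 1 / (2 * p) = 1 / p / 2 := by ring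
      linarith
  -- For `p = 2` the dual exponent is `∞`, and `α ≤ 1/6` makes the power of `s` in the pointwise
  -- bound nonpositive.
  rcases hp.eq_or_lt with rfl | hp2
  · refine ⟨∞, ⟨by simp⟩, ENNReal.ofReal 64, ENNReal.ofReal_ne_top, fun k => ?_⟩
    rw [eLpNorm_exponent_top]
    refine eLpNormEssSup_le_of_ae_bound (Eventually.of_forall fun x => ?_)
    have h := weighted_hermiteFn_le hα0 hα14 k x
    rw [norm_mul, Real.norm_of_nonneg (by positivity)]
    refine h.trans (mul_le_of_le_one_right ?_ (hermiteProfile_le_one _ _) |>.trans ?_)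
    · have := one_le_hermiteScale k
      positivity
    · have : hermiteScale k ^ (3 * α - 1 / 2) ≤ 1 := by
        refine Real.rpow_le_one_of_one_le_of_nonpos (one_le_hermiteScale k) ?_
        norm_num [tExp] at hα
        linarith
      linarith
  · have hp2' : 0 < p - 2 := by linarith
    obtain ⟨q, hqdef⟩ : ∃ q, q = 2 * p / (p - 2) := ⟨_, rfl⟩
    have hq0 : 0 < q := by rw [hqdef]; positivity
    have hqp : q * (1 / p) = q / 2 - 1 := by rw [hqdef]; field_simp; ring
    have hinv : p⁻¹ + q⁻¹ = 2⁻¹ := by rw [hqdef]; field_simp; ring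
    refine ⟨ENNReal.ofReal q, ⟨?_⟩, eLpNorm_weighted_hermiteFn_le hq0 hα0 hα14 ?_ ?_⟩
    · rw [← ENNReal.ofReal_inv_of_pos hp0, ← ENNReal.ofReal_inv_of_pos hq0,
        ← ENNReal.ofReal_add (by positivity) (by positivity), hinv,
        ENNReal.ofReal_inv_of_pos (by norm_num)]
      simp
    all_goals unfold tExp at hα
    all_goals split_ifs at hα with h4
    · have h3 : α ≤ 1 / 3 - 1 / p / 3 := by
        have : 2 / p = 2 * (1 / p) := by ring
        linarith
      nlinarith
    · have h3 : α ≤ 1 / p := by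
        have : 1 / (2 * p) = 1 / p / 2 := by ring
        linarith
      have h5 : q * α ≤ q / 2 - 1 := by rw [← hqp]; gcongr
      have h6 : q ≤ 4 := by
        rw [hqdef, div_le_iff₀ hp2']
        linarith
      linarith
    · left
      rw [hqdef, lt_div_iff₀ hp2']
      linarith
    · right
      have h3 : α ≤ 1 / p := by
        have : 1 / (2 * p) = 1 / p / 2 := by ring
        linarith
      have h5 : q * α ≤ q / 2 - 1 := by rw [← hqp]; gcongr
      refine ⟨?_, by linarith⟩
      -- At `p = q = 4` the strict inequality amounts to `α < 1/4`; this is where the excluded pair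
      -- enters.
      rcases (not_lt.1 h4).eq_or_lt with rfl | h4'
      · have h7 : α < 1 / 4 := lt_of_le_of_ne h3 fun h => hne (by rw [h])
        have h8 : q = 4 := by rw [hqdef]; norm_num
        rw [h8]
        linarith
      · have h6 : q < 4 := by
          rw [hqdef, div_lt_iff₀ hp2']
          linarith
        linarith

theorem contEmbeds_weightedSpace {p α : ℝ} (hp : 2 ≤ p) (hα : α / 2 + tExp p ≤ 0)
    (hne : (p, α) ≠ (4, 1 / 4)) :
    ContEmbeds (weightedSpace p α) (weightedNorm p α) vSpace vNorm := by
  obtain ⟨q, hq, M, hM, hbound⟩ := exists_weighted_hermiteFn_bound hp hα hne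
  have hwpos : ∀ (β x : ℝ), 0 < (1 + x ^ 2) ^ β := fun β x => by positivity
  have hwcont : ∀ β : ℝ, Continuous fun x : ℝ => (((1 + x ^ 2) ^ β : ℝ) : ℂ) := fun β =>
    Complex.continuous_ofReal.comp
      (Continuous.rpow_const (by fun_prop) fun x => Or.inl (by positivity))
  have hcancel : ∀ (x : ℝ) (z : ℂ),
      (((1 + x ^ 2) ^ (α / 2) : ℝ) : ℂ) * ((((1 + x ^ 2) ^ (-α / 2) : ℝ) : ℂ) * z) = z := by
    intro x z
    rw [← mul_assoc, ← Complex.ofReal_mul, ← Real.rpow_add (by positivity)]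
    simp [neg_div]
  have hholder : ∀ (k : ℕ) (c : ℝ → ℂ), AEStronglyMeasurable c volume →
      eLpNorm (fun x => (((1 + x ^ 2) ^ (α / 2) : ℝ) : ℂ) * c x * (hermiteFn k x : ℂ)) 2 volume ≤
        M * eLpNorm c (ENNReal.ofReal p) volume := by
    intro k c hc
    have hm : AEStronglyMeasurable
        (fun x => (((1 + x ^ 2) ^ (α / 2) * hermiteFn k x : ℝ) : ℂ)) volume := by
      have := ((hwcont (α / 2)).mul
        (Complex.continuous_ofReal.comp (continuous_hermiteFn k))).aestronglyMeasurable
        (μ := volume)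
      refine this.congr (Eventually.of_forall fun x => ?_)
      simp
    have h := eLpNorm_smul_le_mul_eLpNorm (r := 2) (p := ENNReal.ofReal p) (q := q) hm hc
    have heq : eLpNorm (fun x => (((1 + x ^ 2) ^ (α / 2) * hermiteFn k x : ℝ) : ℂ)) q volume =
        eLpNorm (fun x => (1 + x ^ 2) ^ (α / 2) * hermiteFn k x) q volume :=
      eLpNorm_congr_norm_ae (Eventually.of_forall fun x => Complex.norm_real _)
    rw [heq, mul_comm] at h
    refine le_trans (le_of_eq (eLpNorm_congr_ae (Eventually.of_forall fun x => ?_)))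
      (h.trans (by gcongr; exact hbound k))
    simp only [Pi.smul_apply', smul_eq_mul]
    push_cast
    ring
  have hp2 : (2 : ℝ≥0∞) ≤ ENNReal.ofReal p := by
    rw [← ENNReal.ofReal_ofNat]; exact ENNReal.ofReal_le_ofReal hp
  have hmul : ∀ (K : Set ℝ), IsCompact K → ∀ c : ℝ → ℂ, MemLp c 2 (volume.restrict K) →
      MemLp (fun x => (((1 + x ^ 2) ^ (α / 2) : ℝ) : ℂ) * c x) 2 (volume.restrict K) := by
    intro K hK c hc
    obtain ⟨B, hB⟩ := hK.exists_bound_of_continuousOn (hwcont (α / 2)).continuousOn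
    refine hc.of_le_mul (c := B) ((hwcont _).aestronglyMeasurable.mul hc.1) ?_
    refine (ae_restrict_iff' hK.measurableSet).2 (Eventually.of_forall fun x hx => ?_)
    rw [norm_mul]
    gcongr
    exact hB x hx
  refine ContEmbeds.of_bound hM (fun f hf => MemLp.eLpNorm_ne_top hf) (fun f hf K hK => ?_)
    (fun f hf k => ?_) (fun f hf => tendsto_hermiteNorm_of_approx fun ε hε => ?_)
  · have : IsFiniteMeasure (volume.restrict K) := ⟨by simpa using hK.measure_lt_top⟩
    have h := hmul K hK _ ((MemLp.restrict K hf).mono_exponent hp2)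
    simpa only [hcancel] using h
  · have h := hholder k _ (MemLp.aestronglyMeasurable hf)
    simp only [hcancel] at h
    exact h
  -- Compactly supported continuous functions are dense in `L^p`: the weighted function is
  -- approximated within `ε / M`, and the approximant multiplied by the inverse weight lies in `L²`.
  · have hε' : ε / M ≠ 0 := (ENNReal.div_pos hε.ne' hM).ne'
    obtain ⟨g, hgs, hfg, hgc, -⟩ := MemLp.exists_hasCompactSupport_eLpNorm_sub_le
      (p := ENNReal.ofReal p) ENNReal.ofReal_ne_top hf hε'
    refine ⟨fun x => (((1 + x ^ 2) ^ (α / 2) : ℝ) : ℂ) * g x, ?_, fun k => ?_⟩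
    · exact ((hwcont _).mul hgc).memLp_of_hasCompactSupport hgs.mul_left
    · have h := hholder k _ ((MemLp.aestronglyMeasurable hf).sub hgc.aestronglyMeasurable)
      refine le_trans (le_of_eq (congrArg (fun F => eLpNorm F 2 volume) ?_))
        (h.trans ((mul_le_mul_right hfg M).trans ENNReal.mul_div_le))
      funext x
      simp only [Pi.sub_apply, mul_sub, hcancel]

/-- Only uniform boundedness in `L²` is needed, so the case `q = 2`, `α = 0` of the weighted
estimate replaces exact normalization. -/
theorem exists_eLpNorm_hermiteFn_le :
    ∃ M : ℝ≥0∞, M ≠ ∞ ∧ ∀ k, eLpNorm (hermiteFn k) 2 volume ≤ M := by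
  obtain ⟨M, hM, h⟩ := eLpNorm_weighted_hermiteFn_le (q := 2) (α := 0) (by norm_num) le_rfl
    (by norm_num) (by norm_num) (by norm_num)
  exact ⟨M, hM, fun k => by simpa using h k⟩

theorem contEmbeds_linftyZero :
    ContEmbeds linftyZero (fun f => eLpNorm f ∞ volume) vSpace vNorm := by
  obtain ⟨M, hM, hbound⟩ := exists_eLpNorm_hermiteFn_le
  have hmul : ∀ (k : ℕ) (g : ℝ → ℂ),
      eLpNorm (fun x => g x * (hermiteFn k x : ℂ)) 2 volume ≤ M * eLpNorm g ∞ volume := by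
    intro k g
    have h := eLpNorm_smul_le_eLpNorm_top_mul_eLpNorm (μ := volume) 2
      (f := fun x => (hermiteFn k x : ℂ))
      (Complex.continuous_ofReal.comp (continuous_hermiteFn k)).aestronglyMeasurable g
    have heq : eLpNorm (fun x => (hermiteFn k x : ℂ)) 2 volume = eLpNorm (hermiteFn k) 2 volume :=
      eLpNorm_congr_norm_ae (Eventually.of_forall fun x => Complex.norm_real _)
    rw [heq, mul_comm] at h
    exact h.trans (by gcongr; exact hbound k)
  refine ContEmbeds.of_bound hM (fun f hf => hf.1.eLpNorm_ne_top) (fun f hf K hK => ?_)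
    (fun f hf k => hmul k f) (fun f hf => tendsto_hermiteNorm_of_approx fun ε hε => ?_)
  · have : IsFiniteMeasure (volume.restrict K) := ⟨by simpa using hK.measure_lt_top⟩
    exact (hf.1.restrict K).mono_exponent le_top
  · obtain ⟨t, ht⟩ := (ENNReal.tendsto_nhds_zero.1 hf.2 (ε / M) (ENNReal.div_pos hε.ne' hM)).exists
    have hmeas : MeasurableSet {s : ℝ | t ≤ |s|} := measurableSet_le measurable_const measurable_abs
    -- The truncation to `|s| < t` is bounded with bounded support, hence in `L²`; the tail has sup
    -- norm at most `ε / M`.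
    refine ⟨{s : ℝ | t ≤ |s|}ᶜ.indicator f, ?_, fun k => ?_⟩
    · rw [memLp_indicator_iff_restrict hmeas.compl]
      have hfin : volume {s : ℝ | t ≤ |s|}ᶜ < ∞ := by
        refine lt_of_le_of_lt (measure_mono (t := Set.Icc (-t) t) fun x hx => ?_) (by simp)
        exact abs_le.1 (not_le.1 (show ¬ t ≤ |x| from hx)).le
      have : IsFiniteMeasure (volume.restrict {s : ℝ | t ≤ |s|}ᶜ) := ⟨by simpa using hfin⟩
      exact (hf.1.restrict _).mono_exponent le_top
    · have h := hmul k ({s : ℝ | t ≤ |s|}.indicator f)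
      rw [eLpNorm_indicator_eq_eLpNorm_restrict hmeas] at h
      refine le_trans (le_of_eq (congrArg (fun F => eLpNorm F 2 volume) ?_))
        (h.trans ((mul_le_mul_right ht M).trans ENNReal.mul_div_le))
      funext x
      rw [← congrFun (Set.indicator_self_add_compl {s : ℝ | t ≤ |s|} f) x, Pi.add_apply,
        add_sub_cancel_right]

theorem contEmbeds_Lp {p : ℝ} (hp : 2 ≤ p) :
    ContEmbeds (Lp.LpSubmodule ℂ ℂ (ENNReal.ofReal p) volume)
      (fun f => eLpNorm f (ENNReal.ofReal p) volume) vSpace vNorm := by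
  have hne : (p, (0 : ℝ)) ≠ (4, 1 / 4) := fun h => by
    have := congrArg Prod.snd h
    norm_num at this
  obtain ⟨h1, C, h2⟩ := contEmbeds_weightedSpace hp (by linarith [tExp_neg hp]) hne
  have hmem : ∀ f ∈ Lp.LpSubmodule ℂ ℂ (ENNReal.ofReal p) volume, f ∈ weightedSpace p 0 := by
    intro f hf
    have : MemLp f (ENNReal.ofReal p) volume := Lp.mem_Lp_iff_memLp.1 hf
    change MemLp _ _ _
    simpa using this
  refine ⟨fun f hf => h1 (hmem f hf), C, fun f hf => ?_⟩
  simpa [weightedNorm] using h2 f (hmem f hf)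

theorem mainTheorem7 :
    (∀ p α : ℝ, 2 ≤ p → α / 2 + tExp p ≤ 0 → (p, α) ≠ (4, 1 / 4) →
      ContEmbeds (weightedSpace p α) (weightedNorm p α) vSpace vNorm) ∧
    ContEmbeds linftyZero (fun f => eLpNorm f ∞ volume) vSpace vNorm ∧
    (∀ p : ℝ, 2 ≤ p →
      ContEmbeds (Lp.LpSubmodule ℂ ℂ (ENNReal.ofReal p) volume)
        (fun f => eLpNorm f (ENNReal.ofReal p) volume) vSpace vNorm) :=
  ⟨fun _ _ hp hα hne => contEmbeds_weightedSpace hp hα hne, contEmbeds_linftyZero,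
    fun _ hp => contEmbeds_Lp hp⟩
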